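/- Let $X$ be a complex manifold. Call $X$ an Oka manifold if it has the basic Oka property with interpolation: for every Stein manifold $S$, every closed analytic subvariety $T\subset S$ and every continuous map $h:S\to X$ whose restriction $h|_T$ is holomorphic, there is a homotopy $h_t:S\to X$, $t\in[0,1]$, with $h_0=h$, $h_1$ holomorphic, and $h_t|_T=h|_T$ for all $t$. For $n\ge 0$ let $T_n=\{t\in\mathbb R^{n+1}: t_0+\dots+t_n=1,\ t_j\ge 0\}$ and let $A_n=\{t\in\mathbb C^{n+1}: t_0+\dots+t_n=1\}$, a complex manifold biholomorphic to $\mathbb C^n$. An order-preserving map $\theta:\{0,\dots,n\}\to\{0,\dots,m\}$ induces $\theta_*:T_n\to T_m$ and $\theta_*:A_n\to A_m$ by $(\theta_*t)_i=\sum_{j\in\theta^{-1}(i)}t_j$. Let $sX=\mathscr C(T_\bullet,X)$ be the singular set of $X$, and let the affine singular set $eX=\mathcal O(A_\bullet,X)$ be the simplicial set whose $n$-simplices are the holomorphic maps $A_n\to X$, the structure maps in both cases being precomposition by $\theta_*$. Restriction of maps from $A_n$ to $T_n$ defines a morphism $eX\to sX$. Theorem. Every Oka manifold $X$ is homotopically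 elliptic, that is, $eX\to sX$ is a monomorphism and (a) $eX$ is a Kan complex and the inclusion $eX\hookrightarrow sX$ is a weak equivalence of simplicial sets (its geometric realization is a weak homotopy equivalence); (b) the inclusion $eX\hookrightarrow sX$ is the inclusion of a strong deformation retract: there are a morphism $r:sX\to eX$ that restricts to the identity on $eX$ and a simplicial homotopy $sX\times\Delta^1\to sX$ from the identity of $sX$ to $r$ (followed by the inclusion) that is constant on $eX$. -/

import Mathlib

open CategoryTheory MonoidalCategory CartesianMonoidalCategory Opposite
open scoped Topology Simplicial

universe u v

/-- The map induced by a continuous map on the sets of path components. -/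
def ContinuousMap.mapPathComponents {A B : Type*} [TopologicalSpace A] [TopologicalSpace B]
    (f : C(A, B)) : ZerothHomotopy A → ZerothHomotopy B :=
  Quotient.map f fun _ _ h => h.map f.continuous

/-- The map induced by a continuous map on homotopy groups. -/
def ContinuousMap.mapHomotopyGroup {A B : Type*} [TopologicalSpace A] [TopologicalSpace B]
    (f : C(A, B)) (n : ℕ) (a : A) :
    HomotopyGroup (Fin n) A a → HomotopyGroup (Fin n) B (f a) :=
  Quotient.map
    (fun p => (⟨f.comp p.1, fun y hy => congrArg f (p.2 y hy)⟩ : GenLoop (Fin n) B (f a)))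
    fun _ _ h => h.map fun H => H.compContinuousMap f

/-- A weak homotopy equivalence of topological spaces: a continuous map that induces a bijection of
path components and isomorphisms of homotopy groups for all base points. -/
def ContinuousMap.IsWeakHomotopyEquiv {A B : Type*} [TopologicalSpace A] [TopologicalSpace B]
    (f : C(A, B)) : Prop :=
  Function.Bijective f.mapPathComponents ∧
    ∀ (n : ℕ) (a : A), Function.Bijective (f.mapHomotopyGroup (n + 1) a)

namespace SSet

/-- A weak equivalence of simplicial sets: a map whose geometric realization is a weak homotopy
equivalence. -/
def IsWeakEquivalence {K L : SSet.{u}} (i : K ⟶ L) : Prop :=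
  (SSet.toTop.map i).hom.IsWeakHomotopyEquiv

/-- `i : K ⟶ L` is the inclusion of a strong deformation retract: it has a retraction `r` and there
is a simplicial homotopy from the identity of `L` to `r ≫ i` that is constant on `K`. -/
def IsStrongDeformationRetract {K L : SSet.{u}} (i : K ⟶ L) : Prop :=
  ∃ r : L ⟶ K, i ≫ r = 𝟙 K ∧ ∃ h : L ⊗ Δ[1] ⟶ L,
    ι₀ ≫ h = 𝟙 L ∧ ι₁ ≫ h = r ≫ i ∧ i ▷ Δ[1] ≫ h = fst K Δ[1] ≫ i

end SSet

open scoped Manifold ContDiff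

/-! Throughout, a complex manifold modelled on a finite-dimensional complex normed space `E` is a
Hausdorff charted space `X` on `E` with `IsManifold 𝓘(ℂ, E) ω X`, and a holomorphic map is a
`ContMDiff` map of order `ω`, that is, a map that is complex analytic in charts. -/

section Oka

variable (E : Type*) [NormedAddCommGroup E] [NormedSpace ℂ E]
variable {S : Type*} [TopologicalSpace S] [ChartedSpace E S]

/-- The holomorphically convex hull of `K`: the points `x` such that `|f x| ≤ max_K |f|` for every
holomorphic function `f` on `S` (used for compact `K`, where the maximum is attained). -/
def holomorphicHull (K : Set S) : Set S :=
  {x | ∀ f : S → ℂ, ContMDiff 𝓘(ℂ, E) 𝓘(ℂ, ℂ) ω f → ∃ y ∈ K, ‖f x‖ ≤ ‖f y‖}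

variable (S) in
/-- A complex manifold `S` is Stein if it is Hausdorff and second countable, holomorphically convex,
and its points are separated by holomorphic functions. -/
structure IsStein : Prop where
  isManifold : IsManifold 𝓘(ℂ, E) ω S
  finiteDimensional : FiniteDimensional ℂ E
  t2 : T2Space S
  secondCountable : SecondCountableTopology S
  convex : ∀ K : Set S, IsCompact K → IsCompact (holomorphicHull E K)
  separated : ∀ x y : S, x ≠ y →
    ∃ f : S → ℂ, ContMDiff 𝓘(ℂ, E) 𝓘(ℂ, ℂ) ω f ∧ f x ≠ f y

/-- `T` is a closed analytic subvariety of `S`: near every point of `S` it is the common zero set of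
finitely many holomorphic functions. (Closedness of `T` follows.) -/
def IsAnalyticSubvariety (T : Set S) : Prop :=
  ∀ p : S, ∃ U : Set S, IsOpen U ∧ p ∈ U ∧ ∃ (k : ℕ) (f : Fin k → S → ℂ),
    (∀ i, ContMDiffOn 𝓘(ℂ, E) 𝓘(ℂ, ℂ) ω (f i) U) ∧ T ∩ U = {x | x ∈ U ∧ ∀ i, f i x = 0}

variable (F : Type*) [NormedAddCommGroup F] [NormedSpace ℂ F]
variable {X : Type*} [TopologicalSpace X] [ChartedSpace F X]

/-- The restriction of `h : S → X` to the reduced subvariety `T` is holomorphic: locally at the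
points of `T` it is the restriction of a holomorphic map defined on an open subset of `S`. -/
def IsHolomorphicOnSubvariety (h : S → X) (T : Set S) : Prop :=
  ∀ p ∈ T, ∃ U : Set S, IsOpen U ∧ p ∈ U ∧ ∃ g : S → X,
    ContMDiffOn 𝓘(ℂ, E) 𝓘(ℂ, F) ω g U ∧ Set.EqOn g h (T ∩ U)

variable (X) in
/-- The basic Oka property with interpolation of `X` with respect to `T ⊆ S`: every continuous map
`h : S → X` with `h|T` holomorphic can be deformed to a holomorphic map with `h|T` fixed. -/
def HasBOPI (T : Set S) : Prop :=
  ∀ h : C(S, X), IsHolomorphicOnSubvariety E F h T →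
    ∃ g : C(S, X), ContMDiff 𝓘(ℂ, E) 𝓘(ℂ, F) ω g ∧ h.HomotopicRel g T

end Oka

/-- A complex manifold `X` is Oka if it has the basic Oka property with interpolation with respect
to the inclusion of every closed analytic subvariety `T` of every Stein manifold `S`. -/
def IsOka (F : Type v) [NormedAddCommGroup F] [NormedSpace ℂ F]
    (X : Type u) [TopologicalSpace X] [ChartedSpace F X] : Prop :=
  ∀ (E : Type) [NormedAddCommGroup E] [NormedSpace ℂ E]
    (S : Type) [TopologicalSpace S] [ChartedSpace E S], IsStein E S →
    ∀ T : Set S, IsAnalyticSubvariety E T → HasBOPI E F X T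

/-- The affine simplex `{t ∈ ℂⁿ⁺¹ | t₀ + ⋯ + tₙ = 1}`. -/
def AffineSimplex (n : ℕ) : Type := {t : Fin (n + 1) → ℂ // ∑ i, t i = 1}

namespace AffineSimplex

instance (n : ℕ) : TopologicalSpace (AffineSimplex n) :=
  inferInstanceAs (TopologicalSpace {t : Fin (n + 1) → ℂ // ∑ i, t i = 1})

/-- The affine coordinates `(t₁, …, tₙ)` identify the affine `n`-simplex with `ℂⁿ`. -/
noncomputable def coord (n : ℕ) : AffineSimplex n ≃ₜ (Fin n → ℂ) where
  toFun t i := t.1 i.succ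
  invFun z := ⟨Fin.cons (1 - ∑ i, z i) z, by simp [Fin.sum_univ_succ]⟩
  left_inv t := by
    apply Subtype.ext
    funext i
    have h := t.2
    rw [Fin.sum_univ_succ] at h
    refine Fin.cases ?_ (fun j => ?_) i
    · simp only [Fin.cons_zero]
      linear_combination -h
    · simp
  right_inv z := by
    funext i
    simp
  continuous_toFun :=
    continuous_pi fun i => (continuous_apply i.succ).comp continuous_subtype_val
  continuous_invFun := by
    refine Continuous.subtype_mk (continuous_pi fun i => ?_) _
    refine Fin.cases ?_ (fun j => ?_) i
    · simp only [Fin.cons_zero]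
      fun_prop
    · simp only [Fin.cons_succ]
      fun_prop

/-- The complex structure on the affine `n`-simplex that makes `coord n` biholomorphic. -/
noncomputable instance (n : ℕ) : ChartedSpace (Fin n → ℂ) (AffineSimplex n) :=
  (coord n).toOpenPartialHomeomorph.singletonChartedSpace rfl

instance (n : ℕ) : IsManifold 𝓘(ℂ, Fin n → ℂ) ω (AffineSimplex n) :=
  (coord n).toOpenPartialHomeomorph.isManifold_singleton rfl

/-- The map `θ_* : A_n → A_m`, `(θ_* t)_i = ∑_{θ j = i} t_j`. -/
noncomputable def map {n m : ℕ} (θ : Fin (n + 1) → Fin (m + 1)) (t : AffineSimplex n) :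
    AffineSimplex m :=
  ⟨fun i => ∑ j with θ j = i, t.1 j, by
    rw [Finset.sum_fiberwise]
    exact t.2⟩

lemma map_id {n : ℕ} (t : AffineSimplex n) : map id t = t := by
  apply Subtype.ext
  funext i
  simp [map, Finset.sum_filter]

lemma map_comp {n m k : ℕ} (θ : Fin (n + 1) → Fin (m + 1)) (η : Fin (m + 1) → Fin (k + 1))
    (t : AffineSimplex n) : map η (map θ t) = map (η ∘ θ) t := by
  apply Subtype.ext
  funext i
  simp only [map, Finset.sum_filter, Function.comp]
  have h : ∀ j, (if η j = i then ∑ a, if θ a = j then t.1 a else 0 else 0) =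
      ∑ a, if θ a = j then (if η (θ a) = i then t.1 a else 0) else 0 := by
    intro j
    split_ifs with hj
    · exact Finset.sum_congr rfl fun a _ => by split_ifs <;> simp_all
    · exact (Finset.sum_eq_zero fun a _ => by split_ifs <;> simp_all).symm
  rw [Finset.sum_congr rfl fun j _ => h j, Finset.sum_comm]
  simp

lemma chartAt_eq {n : ℕ} (t : AffineSimplex n) :
    chartAt (Fin n → ℂ) t = (coord n).toOpenPartialHomeomorph :=
  rfl

/-- Holomorphy of a map between affine simplices may be tested in the coordinates `coord`. -/
lemma contMDiff_of_coord {n m : ℕ} {f : AffineSimplex n → AffineSimplex m} (hf : Continuous f)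
    (h : ContDiff ℂ ω fun z => coord m (f ((coord n).symm z))) :
    ContMDiff 𝓘(ℂ, Fin n → ℂ) 𝓘(ℂ, Fin m → ℂ) ω f := by
  rw [contMDiff_iff]
  exact ⟨hf, fun x y => h.contDiffOn⟩

lemma continuous_map {n m : ℕ} (θ : Fin (n + 1) → Fin (m + 1)) : Continuous (map θ) :=
  Continuous.subtype_mk (continuous_pi fun _ => continuous_finsetSum _ fun j _ =>
    (continuous_apply j).comp continuous_subtype_val) _

lemma contMDiff_map {n m : ℕ} (θ : Fin (n + 1) → Fin (m + 1)) :
    ContMDiff 𝓘(ℂ, Fin n → ℂ) 𝓘(ℂ, Fin m → ℂ) ω (map θ) := by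
  have key : ∀ j, ContDiff ℂ ω fun z : Fin n → ℂ => ((coord n).symm z).1 j := by
    refine Fin.cases ?_ (fun k => ?_)
    · have : ContDiff ℂ ω fun z : Fin n → ℂ => 1 - ∑ k, z k := by fun_prop
      exact this
    · exact contDiff_apply ℂ ℂ k
  refine contMDiff_of_coord (continuous_map θ) (contDiff_pi.2 fun i => ?_)
  have : ContDiff ℂ ω fun z : Fin n → ℂ =>
      ∑ j with θ j = i.succ, ((coord n).symm z).1 j := ContDiff.sum fun j _ => key j
  exact this

/-- The inclusion of the standard simplex into the affine simplex. -/
noncomputable def ofStdSimplex (n : ℕ) : C(stdSimplex ℝ (Fin (n + 1)), AffineSimplex n) where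
  toFun t := ⟨fun i => (t.1 i : ℂ), by
    rw [← Complex.ofReal_sum, t.2.2, Complex.ofReal_one]⟩
  continuous_toFun := by
    refine Continuous.subtype_mk (continuous_pi fun i => ?_) _
    exact Complex.continuous_ofReal.comp ((continuous_apply i).comp continuous_subtype_val)

lemma map_ofStdSimplex {n m : ℕ} (θ : Fin (n + 1) → Fin (m + 1))
    (t : stdSimplex ℝ (Fin (n + 1))) :
    map θ (ofStdSimplex n t) = ofStdSimplex m (stdSimplex.map θ t) := by
  apply Subtype.ext
  funext i
  change ∑ j with θ j = i, (t.1 j : ℂ) = ((stdSimplex.map θ t).1 i : ℂ)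
  rw [← Complex.ofReal_sum]
  exact congrArg _ (FunOnFinite.linearMap_apply_apply ℝ ℝ θ t.1 i).symm

end AffineSimplex

section SingularSets

variable (F : Type v) [NormedAddCommGroup F] [NormedSpace ℂ F]
variable (X : Type u) [TopologicalSpace X] [ChartedSpace F X]

/-- The affine singular set `eX` of a complex manifold `X`: its `n`-simplices are the holomorphic
maps `A_n → X`. -/
noncomputable def affineSingularSet : SSet.{u} where
  obj n := {f : AffineSimplex n.unop.len → X //
    ContMDiff 𝓘(ℂ, Fin n.unop.len → ℂ) 𝓘(ℂ, F) ω f}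
  map θ := ↾fun f => ⟨f.1 ∘ AffineSimplex.map θ.unop.toOrderHom,
    f.2.comp (AffineSimplex.contMDiff_map _)⟩
  map_id n := by
    ext f t
    exact congrArg f.1 (AffineSimplex.map_id t)
  map_comp θ η := by
    ext f t
    exact congrArg f.1 (AffineSimplex.map_comp η.unop.toOrderHom θ.unop.toOrderHom t).symm

/-- The natural map `eX → sX` into the topological singular set that restricts holomorphic maps
`A_n → X` to the standard simplex `T_n ⊆ A_n`. -/
noncomputable def affineSingularSetInclusion :
    affineSingularSet F X ⟶ TopCat.toSSet.obj (TopCat.of X) where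
  app n := ↾fun f => ((TopCat.of X).toSSetObjEquiv n).symm
    ((⟨f.1, f.2.continuous⟩ : C(AffineSimplex n.unop.len, X)).comp
      (AffineSimplex.ofStdSimplex n.unop.len))
  naturality n m θ := by
    ext f
    apply ((TopCat.of X).toSSetObjEquiv m).injective
    ext t
    exact congrArg f.1 (AffineSimplex.map_ofStdSimplex _ t)

end SingularSets

/-- `X` is homotopically elliptic: (a) the affine singular set is fibrant and its inclusion into the
singular set is a weak equivalence, and (b) this inclusion is the inclusion of a strong deformation
retract. -/
structure IsHomotopicallyElliptic (F : Type v) [NormedAddCommGroup F] [NormedSpace ℂ F]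
    (X : Type u) [TopologicalSpace X] [ChartedSpace F X] : Prop where
  kanComplex : SSet.KanComplex (affineSingularSet F X)
  mono : Mono (affineSingularSetInclusion F X)
  isWeakEquivalence : SSet.IsWeakEquivalence (affineSingularSetInclusion F X)
  isStrongDeformationRetract : SSet.IsStrongDeformationRetract (affineSingularSetInclusion F X)

/-! Consider the simplicial set `holomorphicPathSet`: its n-simplices are homotopies T_n × I → X,
stationary near time 1, together with a holomorphic map on A_n that extends the final map. Constant
homotopies map eX into it; `source` and `target` send it to sX and eX. The crux is that `source` has
the right lifting property against ∂Δ[n] → Δ[n], hence against all monomorphisms. As eX → sX is a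
monomorphism (identity theorem), the constant homotopies over eX extend to a section s of `source`.
Then r = s ≫ `target` is the retraction, and running along the chosen homotopies gives the
deformation. The Kan property passes from sX to its retract eX. The lifting property is
`exists_filling`. Compatible holomorphic maps on the coordinate hyperplanes of A_n form a
holomorphic map on their union, an analytic subvariety of the Stein manifold A_n. A continuous
self-map of A_n with image in T_n ∪ hyperplanes, fixing the hyperplanes and preserving T_n, extends
the data to A_n up to a homotopy on T_n relative to ∂T_n. The Oka property then makes the extension
holomorphic without changing it on the hyperplanes. For the weak equivalence, the homotopy on |sX|
is built from the (2n+1)-simplices T_{2n+1} → T_n × I → X, in which straight segments join two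
copies of T_n (`SSet.Doubling`). It may move points of |eX|, but only inside |eX|;
`ContinuousMap.isWeakHomotopyEquiv_of_retraction` shows that this suffices. -/

namespace AffineSimplex

/-! ### Holomorphic coordinates and complex lines in affine simplices. -/

lemma contMDiff_coord (n : ℕ) :
    ContMDiff 𝓘(ℂ, Fin n → ℂ) 𝓘(ℂ, Fin n → ℂ) ω (coord n) := by
  rw [contMDiff_iff]
  refine ⟨(coord n).continuous, fun x y => ?_⟩
  have : ContDiff ℂ ω fun z : Fin n → ℂ => z := contDiff_id
  refine this.contDiffOn.congr fun z _ => ?_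
  exact (coord n).apply_symm_apply z

lemma contMDiff_coord_symm (n : ℕ) :
    ContMDiff 𝓘(ℂ, Fin n → ℂ) 𝓘(ℂ, Fin n → ℂ) ω (coord n).symm := by
  rw [contMDiff_iff]
  refine ⟨(coord n).symm.continuous, fun x y => ?_⟩
  have : ContDiff ℂ ω fun z : Fin n → ℂ => z := contDiff_id
  refine this.contDiffOn.congr fun z _ => ?_
  exact (coord n).apply_symm_apply z

/-- The barycentric coordinates are holomorphic functions. -/
lemma contMDiff_apply {n : ℕ} (j : Fin (n + 1)) :
    ContMDiff 𝓘(ℂ, Fin n → ℂ) 𝓘(ℂ, ℂ) ω fun t : AffineSimplex n => t.1 j := by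
  have key : ContDiff ℂ ω fun z : Fin n → ℂ => ((coord n).symm z).1 j := by
    refine Fin.cases ?_ (fun k => ?_) j
    · have : ContDiff ℂ ω fun z : Fin n → ℂ => 1 - ∑ k, z k := by fun_prop
      exact this
    · exact contDiff_apply ℂ ℂ k
  exact (key.contMDiff.comp (contMDiff_coord n)).congr fun t => by simp

/-- A map into an affine simplex is holomorphic if its barycentric coordinates are. -/
lemma contMDiff_of_apply {n : ℕ} {E M : Type*} [NormedAddCommGroup E] [NormedSpace ℂ E]
    [TopologicalSpace M] [ChartedSpace E M] {f : M → AffineSimplex n}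
    (h : ∀ j, ContMDiff 𝓘(ℂ, E) 𝓘(ℂ, ℂ) ω fun x => (f x).1 j) :
    ContMDiff 𝓘(ℂ, E) 𝓘(ℂ, Fin n → ℂ) ω f := by
  have : ContMDiff 𝓘(ℂ, E) 𝓘(ℂ, Fin n → ℂ) ω fun x => coord n (f x) :=
    contMDiff_pi_space.2 fun i => h i.succ
  exact ((contMDiff_coord_symm n).comp this).congr fun t => by simp

/-- The complex line through `t` in the direction `v`. -/
noncomputable def line {n : ℕ} (t : AffineSimplex n) (v : Fin (n + 1) → ℂ) (hv : ∑ i, v i = 0)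
    (z : ℂ) : AffineSimplex n :=
  ⟨fun i => t.1 i + z * v i, by rw [Finset.sum_add_distrib, t.2, ← Finset.mul_sum, hv]; simp⟩

lemma contMDiff_line {n : ℕ} (t : AffineSimplex n) (v : Fin (n + 1) → ℂ) (hv : ∑ i, v i = 0) :
    ContMDiff 𝓘(ℂ, ℂ) 𝓘(ℂ, Fin n → ℂ) ω (line t v hv) := by
  refine contMDiff_of_apply fun j => ?_
  have : ContDiff ℂ ω fun z : ℂ => t.1 j + z * v j := by fun_prop
  exact this.contMDiff

end AffineSimplex

/-! ### The identity theorem and injectivity of eX → sX. -/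

section IdentityTheorem

variable {F : Type v} [NormedAddCommGroup F] [NormedSpace ℂ F]
variable {X : Type u} [TopologicalSpace X] [ChartedSpace F X]

/-- Since X is Hausdorff, the maps agree at z itself, so one chart serves both and the identity
theorem for vector-valued analytic functions applies. -/
lemma eventually_eq_of_frequently_eq [T2Space X] {f g : ℂ → X}
    (hf : ContMDiff 𝓘(ℂ, ℂ) 𝓘(ℂ, F) ω f) (hg : ContMDiff 𝓘(ℂ, ℂ) 𝓘(ℂ, F) ω g) {z : ℂ}
    (h : ∃ᶠ w in 𝓝[≠] z, f w = g w) : ∀ᶠ w in 𝓝 z, f w = g w := by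
  have hz : f z = g z := by
    by_contra hne
    refine h ?_
    have : ∀ᶠ w in 𝓝 z, f w ≠ g w :=
      (isOpen_ne_fun hf.continuous hg.continuous).mem_nhds hne
    exact this.filter_mono nhdsWithin_le_nhds
  have hchart (k : ℂ → X) (hk : ContMDiff 𝓘(ℂ, ℂ) 𝓘(ℂ, F) ω k) (hkz : k z = f z) :
      AnalyticAt ℂ (fun w => chartAt F (f z) (k w)) z := by
    have h1 := (contMDiffAt_iff_target.1 (hk z)).2.contDiffAt
    rw [hkz] at h1
    exact ContDiffAt.analyticAt h1
  have hsrc (k : ℂ → X) (hk : ContMDiff 𝓘(ℂ, ℂ) 𝓘(ℂ, F) ω k) (hkz : k z = f z) :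
      ∀ᶠ w in 𝓝 z, k w ∈ (chartAt F (f z)).source :=
    hk.continuous.continuousAt.eventually_mem ((chartAt F (f z)).open_source.mem_nhds
      (by rw [hkz]; exact mem_chart_source F _))
  have := ((hchart f hf rfl).frequently_eq_iff_eventually_eq (hchart g hg hz.symm)).1
    (h.mono fun w hw => by rw [hw])
  filter_upwards [this, hsrc f hf rfl, hsrc g hg hz.symm] with w h1 h2 h3
  exact (chartAt F (f z)).injOn h2 h3 h1

/-- Two holomorphic maps from `ℂ` to a Hausdorff complex manifold that agree at a sequence of points
accumulating at `z` are equal. -/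
lemma eq_of_frequently_eq [T2Space X] {f g : ℂ → X}
    (hf : ContMDiff 𝓘(ℂ, ℂ) 𝓘(ℂ, F) ω f) (hg : ContMDiff 𝓘(ℂ, ℂ) 𝓘(ℂ, F) ω g) {z : ℂ}
    (h : ∃ᶠ w in 𝓝[≠] z, f w = g w) : f = g := by
  -- The set where the germs agree is open by definition. At a point of its closure the maps agree
  -- frequently, so the local statement applies.
  have hcl : IsClopen {w | ∀ᶠ x in 𝓝 w, f x = g x} := by
    refine ⟨isClosed_iff_frequently.2 fun w hw => ?_, isOpen_setOfPred_eventually_nhds⟩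
    refine eventually_eq_of_frequently_eq hf hg ?_
    intro hne
    have h2 : ∀ᶠ x in 𝓝 w, ∀ᶠ y in 𝓝 x, y ∈ ({w}ᶜ : Set ℂ) → f y ≠ g y :=
      eventually_eventually_nhds.2 (eventually_nhdsWithin_iff.1 hne)
    obtain ⟨x, hx1, hx2⟩ := (hw.and_eventually h2).exists
    have h3 : ∀ᶠ y in 𝓝[≠] x, y ∈ ({w}ᶜ : Set ℂ) → False :=
      ((hx1.and hx2).mono fun y hy hyw => hy.2 hyw hy.1).filter_mono nhdsWithin_le_nhds
    -- The point x may be w itself; in either case there are points near x different from w.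
    have h4 : ∀ᶠ y in 𝓝[≠] x, y ∈ ({w}ᶜ : Set ℂ) := by
      by_cases hxw : x = w
      · subst hxw; exact self_mem_nhdsWithin
      · exact nhdsWithin_le_nhds (isOpen_compl_singleton.mem_nhds hxw)
    obtain ⟨y, hy1, hy2⟩ := (h3.and h4).exists
    exact hy1 hy2
  have huniv := hcl.eq_univ ⟨z, eventually_eq_of_frequently_eq hf hg h⟩
  funext w
  have : w ∈ {w | ∀ᶠ x in 𝓝 w, f x = g x} := huniv ▸ Set.mem_univ w
  exact this.self_of_nhds

lemma frequently_of_real {p : ℂ → Prop} (h : ∀ᶠ s : ℝ in 𝓝 0, p s) : ∃ᶠ w in 𝓝[≠] 0, p w := by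
  have h1 : Filter.Tendsto (fun s : ℝ => (s : ℂ)) (𝓝[≠] 0) (𝓝[≠] 0) := by
    refine tendsto_nhdsWithin_iff.2 ⟨?_, ?_⟩
    · have := Complex.continuous_ofReal.tendsto 0
      rw [Complex.ofReal_zero] at this
      exact this.mono_left nhdsWithin_le_nhds
    · filter_upwards [self_mem_nhdsWithin] with s hs
      simpa using hs
  refine h1.frequently (Filter.Eventually.frequently ?_)
  exact h.filter_mono nhdsWithin_le_nhds

/-- A holomorphic map on the affine simplex is determined by its values on the standard simplex. -/
lemma AffineSimplex.eq_of_eq_ofStdSimplex [T2Space X] {n : ℕ} {f g : AffineSimplex n → X}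
    (hf : ContMDiff 𝓘(ℂ, Fin n → ℂ) 𝓘(ℂ, F) ω f) (hg : ContMDiff 𝓘(ℂ, Fin n → ℂ) 𝓘(ℂ, F) ω g)
    (h : ∀ x, f (ofStdSimplex n x) = g (ofStdSimplex n x)) : f = g := by
  have hline (t : AffineSimplex n) (v : Fin (n + 1) → ℂ) (hv : ∑ i, v i = 0)
      (hs : ∀ᶠ s : ℝ in 𝓝 0, f (line t v hv s) = g (line t v hv s)) (z : ℂ) :
      f (line t v hv z) = g (line t v hv z) :=
    congrFun (eq_of_frequently_eq (hf.comp (contMDiff_line t v hv))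
      (hg.comp (contMDiff_line t v hv)) (frequently_of_real hs)) z
  have hreal (t : AffineSimplex n) (ht : ∀ j, (t.1 j).im = 0) : f t = g t := by
    -- The barycentre is interior to T_n, so the line from it to a real point t runs inside T_n for
    -- small real parameters and reaches t at parameter 1.
    let b : AffineSimplex n := ⟨fun _ => 1 / (n + 1 : ℂ), by
      have : (n + 1 : ℂ) ≠ 0 := by exact_mod_cast n.succ_ne_zero
      simp [field]⟩
    have hv : ∑ i, (t.1 i - b.1 i) = 0 := by rw [Finset.sum_sub_distrib, t.2, b.2, sub_self]
    have hre : ∑ i, (t.1 i).re = 1 := by rw [← Complex.re_sum, t.2, Complex.one_re]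
    have key := hline b (fun i => t.1 i - b.1 i) hv ?_ 1
    · have : line b (fun i => t.1 i - b.1 i) hv 1 = t := by
        apply Subtype.ext; funext i; simp [line]
      rwa [this] at key
    · have hpos : ∀ᶠ s : ℝ in 𝓝 0, ∀ i, 0 ≤ 1 / (n + 1 : ℝ) + s * ((t.1 i).re - 1 / (n + 1)) := by
        refine Filter.eventually_all.2 fun i => ?_
        have hc : Continuous fun s : ℝ => 1 / (n + 1 : ℝ) + s * ((t.1 i).re - 1 / (n + 1)) := by
          fun_prop
        have h0 : 0 < 1 / (n + 1 : ℝ) + 0 * ((t.1 i).re - 1 / (n + 1)) := by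
          rw [zero_mul, add_zero]
          positivity
        exact ((hc.tendsto 0).eventually_const_lt h0).mono fun s hs => hs.le
      filter_upwards [hpos] with s hs
      have : line b (fun i => t.1 i - b.1 i) hv s = ofStdSimplex n
          ⟨fun i => 1 / (n + 1 : ℝ) + s * ((t.1 i).re - 1 / (n + 1)), hs, by
            have : (n + 1 : ℝ) ≠ 0 := by positivity
            simp only [Finset.sum_add_distrib, ← Finset.mul_sum, Finset.sum_sub_distrib, hre]
            simp [field]⟩ := by
        apply Subtype.ext
        funext i
        simp only [line, b]
        have h1 : t.1 i = ((t.1 i).re : ℂ) := by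
          apply Complex.ext <;> simp [ht]
        rw [h1]
        change _ = ((1 / (n + 1 : ℝ) + s * ((t.1 i).re - 1 / (n + 1)) : ℝ) : ℂ)
        push_cast
        simp
      rw [this]
      exact h _
  funext t
  -- The line through Re t in the direction Im t is real at real parameters and reaches t at the
  -- parameter `Complex.I`.
  let x : AffineSimplex n := ⟨fun i => ((t.1 i).re : ℂ), by
    rw [← Complex.ofReal_sum, ← Complex.re_sum, t.2]; simp⟩
  have hv : ∑ i, ((t.1 i).im : ℂ) = 0 := by
    rw [← Complex.ofReal_sum, ← Complex.im_sum, t.2]; simp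
  have key := hline x (fun i => ((t.1 i).im : ℂ)) hv
    (Filter.Eventually.of_forall fun s => hreal _ fun j => by simp [line, x]) Complex.I
  have : line x (fun i => ((t.1 i).im : ℂ)) hv Complex.I = t := by
    apply Subtype.ext
    funext i
    simp only [line, x]
    rw [mul_comm]
    exact Complex.re_add_im _
  rwa [this] at key

end IdentityTheorem

lemma affineSingularSetInclusion_app_apply {F : Type v} [NormedAddCommGroup F] [NormedSpace ℂ F]
    {X : Type u} [TopologicalSpace X] [ChartedSpace F X] {n : SimplexCategoryᵒᵖ}
    (g : (affineSingularSet F X).obj n) (x : stdSimplex ℝ (Fin (n.unop.len + 1))) :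
    (TopCat.of X).toSSetObjEquiv n ((affineSingularSetInclusion F X).app n g) x =
      g.1 (AffineSimplex.ofStdSimplex _ x) := rfl

lemma mono_affineSingularSetInclusion (F : Type v) [NormedAddCommGroup F] [NormedSpace ℂ F]
    (X : Type u) [TopologicalSpace X] [T2Space X] [ChartedSpace F X] :
    Mono (affineSingularSetInclusion F X) := by
  have (n : SimplexCategoryᵒᵖ) : Mono ((affineSingularSetInclusion F X).app n) := by
    rw [mono_iff_injective]
    intro f g h
    refine Subtype.ext (AffineSimplex.eq_of_eq_ofStdSimplex f.2 g.2 fun x => ?_)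
    rw [← affineSingularSetInclusion_app_apply f, ← affineSingularSetInclusion_app_apply g, h]
  exact NatTrans.mono_of_mono_app _

/-! ### Affine simplices as Stein manifolds, and holomorphy on the union of the coordinate
hyperplanes. -/

namespace AffineSimplex

instance (n : ℕ) : T2Space (AffineSimplex n) :=
  inferInstanceAs (T2Space {t : Fin (n + 1) → ℂ // ∑ i, t i = 1})

instance (n : ℕ) : SecondCountableTopology (AffineSimplex n) :=
  inferInstanceAs (SecondCountableTopology {t : Fin (n + 1) → ℂ // ∑ i, t i = 1})

lemma continuous_apply {n : ℕ} (j : Fin (n + 1)) : Continuous fun t : AffineSimplex n => t.1 j :=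
  (_root_.continuous_apply j).comp continuous_subtype_val

lemma map_apply {n m : ℕ} (θ : Fin (n + 1) → Fin (m + 1)) (t : AffineSimplex n)
    (i : Fin (m + 1)) : (map θ t).1 i = ∑ j with θ j = i, t.1 j := rfl

/-- The hull is an intersection of closed sublevel sets, and the coordinate functions alone confine
it to a compact polydisc. -/
lemma isCompact_holomorphicHull {n : ℕ} {K : Set (AffineSimplex n)} (hK : IsCompact K) :
    IsCompact (holomorphicHull (Fin n → ℂ) K) := by
  rcases K.eq_empty_or_nonempty with rfl | hne
  · convert isCompact_empty
    refine Set.eq_empty_of_forall_notMem fun x hx => ?_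
    obtain ⟨y, hy, -⟩ := hx (fun _ => 0) contMDiff_const
    exact hy
  · have hcl : IsClosed (holomorphicHull (Fin n → ℂ) K) := by
      have : holomorphicHull (Fin n → ℂ) K = ⋂ (f : AffineSimplex n → ℂ)
          (_ : ContMDiff 𝓘(ℂ, Fin n → ℂ) 𝓘(ℂ, ℂ) ω f), {x | ∃ y ∈ K, ‖f x‖ ≤ ‖f y‖} := by
        ext x; simp [holomorphicHull]
      rw [this]
      refine isClosed_iInter fun f => isClosed_iInter fun hf => ?_
      obtain ⟨y, hy, hmax⟩ := hK.exists_isMaxOn hne hf.continuous.norm.continuousOn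
      have : {x | ∃ y ∈ K, ‖f x‖ ≤ ‖f y‖} = {x | ‖f x‖ ≤ ‖f y‖} := by
        ext x
        exact ⟨fun ⟨z, hz, h⟩ => h.trans (hmax hz), fun h => ⟨y, hy, h⟩⟩
      rw [this]
      exact isClosed_le hf.continuous.norm continuous_const
    obtain ⟨R, hR⟩ := (hK.image (coord n).continuous).isBounded.exists_norm_le
    have hR0 : 0 ≤ R := (norm_nonneg _).trans (hR _ ⟨_, hne.some_mem, rfl⟩)
    have hc : IsCompact (coord n ⁻¹' Metric.closedBall 0 R) :=
      (coord n).isCompact_preimage.2 (isCompact_closedBall 0 R)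
    refine hc.of_isClosed_subset hcl fun x hx => ?_
    rw [Set.mem_preimage, mem_closedBall_zero_iff, pi_norm_le_iff_of_nonneg hR0]
    intro i
    obtain ⟨y, hy, h⟩ := hx _ (contMDiff_apply i.succ)
    exact h.trans ((norm_le_pi_norm (coord n y) i).trans (hR _ ⟨y, hy, rfl⟩))

/-- Affine simplices are Stein manifolds. -/
lemma isStein (n : ℕ) : IsStein (Fin n → ℂ) (AffineSimplex n) where
  isManifold := inferInstance
  finiteDimensional := inferInstance
  t2 := inferInstance
  secondCountable := inferInstance
  convex _ := isCompact_holomorphicHull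
  separated x y hxy := by
    have : ∃ j, x.1 j ≠ y.1 j := by
      by_contra! h
      exact hxy (Subtype.ext (funext h))
    obtain ⟨j, hj⟩ := this
    exact ⟨_, contMDiff_apply j, hj⟩

/-- The union of the coordinate hyperplanes of the affine simplex. -/
def boundary (n : ℕ) : Set (AffineSimplex n) := {t | ∃ j, t.1 j = 0}

/-- One global equation suffices: the product of the barycentric coordinates. -/
lemma isAnalyticSubvariety_boundary (n : ℕ) :
    IsAnalyticSubvariety (Fin n → ℂ) (boundary n) := by
  refine fun p => ⟨Set.univ, isOpen_univ, Set.mem_univ p, 1, fun _ t => ∏ j, t.1 j, fun _ => ?_, ?_⟩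
  · have : ContMDiff 𝓘(ℂ, Fin n → ℂ) 𝓘(ℂ, ℂ) ω fun t : AffineSimplex n => ∏ j, t.1 j :=
      contMDiff_finsetProd fun j _ => contMDiff_apply j
    exact this.contMDiffOn
  · ext t
    simp [boundary, Finset.prod_eq_zero_iff]

/-- The projection to the hyperplane `t_m = 0` that moves the coordinate `t_m` to `t_k`. -/
noncomputable def proj {n : ℕ} (m k : Fin (n + 1)) : AffineSimplex n → AffineSimplex n :=
  map (Function.update id m k)

lemma proj_apply_self {n : ℕ} {m k : Fin (n + 1)} (hmk : k ≠ m) (t : AffineSimplex n) :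
    (proj m k t).1 m = 0 := by
  rw [proj, map_apply]
  refine Finset.sum_eq_zero fun j hj => ?_
  simp only [Finset.mem_filter, Finset.mem_univ, true_and] at hj
  rcases eq_or_ne j m with rfl | h
  · simp [hmk] at hj
  · simp [h] at hj

lemma proj_apply_of_ne {n : ℕ} {m k i : Fin (n + 1)} (him : i ≠ m) (hik : i ≠ k)
    (t : AffineSimplex n) : (proj m k t).1 i = t.1 i := by
  rw [proj, map_apply, Finset.sum_eq_single i]
  · intro j hj hji
    simp only [Finset.mem_filter, Finset.mem_univ, true_and] at hj
    rcases eq_or_ne j m with rfl | h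
    · simp [hik.symm] at hj
    · simp [Function.update_of_ne h, hji] at hj
  · intro h
    simp [Function.update_of_ne him] at h

lemma map_eq_self {n : ℕ} {θ : Fin (n + 1) → Fin (n + 1)} {t : AffineSimplex n}
    (h : ∀ i, t.1 i ≠ 0 → θ i = i) : map θ t = t := by
  apply Subtype.ext
  funext i
  rw [map_apply, Finset.sum_filter, Finset.sum_eq_single i]
  · split_ifs with hi
    · rfl
    · by_contra h0
      exact hi (h i (Ne.symm h0))
  · intro j _ hji
    split_ifs with hj
    · by_contra h0
      exact hji ((h j h0).symm.trans hj)
    · rfl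
  · simp

lemma proj_eq_self {n : ℕ} {m k : Fin (n + 1)} {t : AffineSimplex n} (ht : t.1 m = 0) :
    proj m k t = t := by
  refine map_eq_self fun i hi => ?_
  have : i ≠ m := fun h => hi (h ▸ ht)
  simp [Function.update_of_ne this]

/-- Holomorphic functions on hyperplanes through `p` that agree on the intersections are near `p`
the restrictions of one holomorphic function. -/
lemma exists_contMDiffAt_extension {F : Type*} [NormedAddCommGroup F] [NormedSpace ℂ F] {n : ℕ}
    {p : AffineSimplex n} (g : Fin (n + 1) → AffineSimplex n → F) (J : Finset (Fin (n + 1)))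
    (hp : ∀ j ∈ J, p.1 j = 0)
    (hg : ∀ j ∈ J, ContMDiffAt 𝓘(ℂ, Fin n → ℂ) 𝓘(ℂ, F) ω (g j) p)
    (hcompat : ∀ i ∈ J, ∀ j ∈ J, ∀ t : AffineSimplex n, t.1 i = 0 → t.1 j = 0 → g i t = g j t) :
    ∃ G : AffineSimplex n → F, ContMDiffAt 𝓘(ℂ, Fin n → ℂ) 𝓘(ℂ, F) ω G p ∧
      ∀ᶠ t in 𝓝 p, ∀ j ∈ J, t.1 j = 0 → G t = g j t := by
  -- Such a k lies outside J, so moving a coordinate into the k-th one disturbs none of the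
  -- hyperplanes in question.
  obtain ⟨k, hk⟩ : ∃ k, p.1 k ≠ 0 := by
    by_contra! h
    simpa [h] using p.2
  induction J using Finset.induction_on with
  | empty => exact ⟨fun _ => 0, contMDiffAt_const, by simp⟩
  | insert m J hm ih =>
    obtain ⟨G, hG, hGJ⟩ := ih (fun j hj => hp j (Finset.mem_insert_of_mem hj))
      (fun j hj => hg j (Finset.mem_insert_of_mem hj))
      fun i hi j hj => hcompat i (Finset.mem_insert_of_mem hi) j (Finset.mem_insert_of_mem hj)
    have hpm := hp m (Finset.mem_insert_self _ _)
    have hproj : proj m k p = p := proj_eq_self hpm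
    have hkm : k ≠ m := fun h => hk (h ▸ hpm)
    have hcont : Filter.Tendsto (proj m k) (𝓝 p) (𝓝 p) := by
      have := (continuous_map (Function.update id m k)).tendsto p
      rwa [show map (Function.update id m k) p = p from hproj] at this
    have hcomp (f : AffineSimplex n → F) (hf : ContMDiffAt 𝓘(ℂ, Fin n → ℂ) 𝓘(ℂ, F) ω f p) :
        ContMDiffAt 𝓘(ℂ, Fin n → ℂ) 𝓘(ℂ, F) ω (fun t => f (proj m k t)) p := by
      rw [← hproj] at hf
      exact hf.comp p (contMDiff_map _).contMDiffAt
    -- The error g_m - G on t_m = 0 is pulled back along the projection and added. If t_j = 0 with j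
    -- in J, the projected point lies on both hyperplanes, where g_m = g_j = G, so the correction
    -- vanishes.
    refine ⟨fun t => G t + (g m (proj m k t) - G (proj m k t)),
      hG.add ((hcomp _ (hg m (Finset.mem_insert_self _ _))).sub (hcomp _ hG)), ?_⟩
    filter_upwards [hGJ, hcont.eventually hGJ] with t h1 h2 j hj hjt
    rcases Finset.mem_insert.1 hj with rfl | hjJ
    · rw [proj_eq_self hjt]
      abel
    · have hjm : j ≠ m := fun h => hm (h ▸ hjJ)
      have hjk : j ≠ k := fun h => hk (h ▸ hp j hj)
      have hj0 : (proj m k t).1 j = 0 := (proj_apply_of_ne hjm hjk t).trans hjt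
      rw [h1 j hjJ hjt, h2 j hjJ hj0, hcompat m (Finset.mem_insert_self _ _) j hj _
        (proj_apply_self hkm t) hj0, sub_self, add_zero]

variable {F : Type v} [NormedAddCommGroup F] [NormedSpace ℂ F]
variable {X : Type u} [TopologicalSpace X] [ChartedSpace F X] [IsManifold 𝓘(ℂ, F) ω X]

/-- A map that agrees with a holomorphic map on each coordinate hyperplane is holomorphic on the
union of these hyperplanes. -/
lemma isHolomorphicOnSubvariety_boundary {n : ℕ} {h : AffineSimplex n → X}
    (g : Fin (n + 1) → AffineSimplex n → X)
    (hg : ∀ j, ContMDiff 𝓘(ℂ, Fin n → ℂ) 𝓘(ℂ, F) ω (g j))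
    (hgh : ∀ j (t : AffineSimplex n), t.1 j = 0 → h t = g j t) :
    IsHolomorphicOnSubvariety (Fin n → ℂ) F h (boundary n) := by
  classical
  rintro p ⟨j₀, hj₀⟩
  let J : Finset (Fin (n + 1)) := {j | p.1 j = 0}
  have hJ {j} : j ∈ J ↔ p.1 j = 0 := by simp [J]
  let φ := chartAt F (h p)
  have hgp (j) (hj : j ∈ J) : g j p = h p := (hgh j p (hJ.1 hj)).symm
  have hφ : ContMDiffAt 𝓘(ℂ, F) 𝓘(ℂ, F) ω φ (h p) :=
    contMDiffAt_of_mem_maximalAtlas (IsManifold.chart_mem_maximalAtlas _)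
      (mem_chart_source F (h p))
  -- Values of φ outside its source do no harm: compatibility holds before φ is applied, as both
  -- maps equal h on the intersection.
  obtain ⟨G, hG, hGg⟩ := exists_contMDiffAt_extension (p := p) (fun j t => φ (g j t)) J
    (fun j hj => hJ.1 hj)
    (fun j hj => ContMDiffAt.comp p (by rw [hgp j hj]; exact hφ) (hg j p))
    (fun i _ j _ t hi hj => by rw [← hgh i t hi, ← hgh j t hj])
  have hGp : G p = φ (h p) := by
    rw [hGg.self_of_nhds j₀ (hJ.2 hj₀) hj₀, hgp j₀ (hJ.2 hj₀)]
  have hsymm : ContMDiffAt 𝓘(ℂ, F) 𝓘(ℂ, F) ω φ.symm (G p) :=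
    contMDiffAt_symm_of_mem_maximalAtlas (IsManifold.chart_mem_maximalAtlas _)
      (by rw [hGp]; exact φ.map_source (mem_chart_source F (h p)))
  have hloc := (contMDiffAt_iff_contMDiffAt_nhds (by simp)).1 (hsymm.comp p hG)
  have hsrc : ∀ᶠ t in 𝓝 p, ∀ j ∈ J, g j t ∈ φ.source := by
    refine (Finset.eventually_all J).2 fun j hj => ?_
    refine (hg j).continuous.continuousAt.eventually_mem (φ.open_source.mem_nhds ?_)
    rw [hgp j hj]
    exact mem_chart_source F _
  -- Near p only the hyperplanes through p occur.
  have hne : ∀ᶠ t in 𝓝 p, ∀ j, t.1 j = 0 → j ∈ J := by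
    refine Filter.eventually_all.2 fun j => ?_
    by_cases hj : j ∈ J
    · exact Filter.Eventually.of_forall fun _ _ => hj
    · filter_upwards [(continuous_apply j).continuousAt.eventually_ne (mt hJ.2 hj)] with t ht h0
      exact absurd h0 ht
  obtain ⟨U, hU, hUo, hpU⟩ := eventually_nhds_iff.1 (hloc.and (hGg.and (hsrc.and hne)))
  refine ⟨U, hUo, hpU, fun t => φ.symm (G t), fun t ht => (hU t ht).1.contMDiffWithinAt, ?_⟩
  rintro t ⟨⟨j, hj⟩, ht⟩
  obtain ⟨-, h2, h3, h4⟩ := hU t ht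
  have hjJ := h4 j hj
  change φ.symm (G t) = h t
  rw [h2 j hjJ hj, φ.left_inv (h3 j hjJ), hgh j t hj]

/-- The Oka property for an affine simplex relative to its coordinate hyperplanes. -/
lemma exists_homotopicRel_of_isOka (hX : IsOka F X) {n : ℕ} (φ : C(AffineSimplex n, X))
    (g : Fin (n + 1) → AffineSimplex n → X)
    (hg : ∀ j, ContMDiff 𝓘(ℂ, Fin n → ℂ) 𝓘(ℂ, F) ω (g j))
    (hφ : ∀ j (t : AffineSimplex n), t.1 j = 0 → φ t = g j t) :
    ∃ G : C(AffineSimplex n, X), ContMDiff 𝓘(ℂ, Fin n → ℂ) 𝓘(ℂ, F) ω G ∧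
      φ.HomotopicRel G (boundary n) :=
  hX (Fin n → ℂ) (AffineSimplex n) (isStein n) (boundary n) (isAnalyticSubvariety_boundary n) φ
    (isHolomorphicOnSubvariety_boundary g hg hφ)

end AffineSimplex

/-! ### Homotopy extension and horn extension for standard simplices. -/

/-- A function that is continuous on each of finitely many closed sets becomes continuous after
composition with a continuous map into their union. -/
lemma continuous_comp_of_closed_cover {V W Y ι : Type*} [TopologicalSpace V] [TopologicalSpace W]
    [TopologicalSpace Y] [Finite ι] {C : ι → Set W} (hC : ∀ i, IsClosed (C i)) {R : W → Y}
    (hR : ∀ i, ContinuousOn R (C i)) {ρ : V → W} (hρ : Continuous ρ)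
    (hmem : ∀ w, ∃ i, ρ w ∈ C i) : Continuous fun v => R (ρ v) := by
  have h : ContinuousOn R (⋃ i, C i) :=
    (locallyFinite_of_finite C).continuousOn_iUnion hC fun {i} => hR i
  exact h.comp_continuous hρ fun w => Set.mem_iUnion.2 (hmem w)

namespace stdSimplex

/-- The convex combination `(1 - s) x + s y`. -/
noncomputable def segment {ι : Type*} [Fintype ι] (x y : stdSimplex ℝ ι) (s : unitInterval) :
    stdSimplex ℝ ι :=
  ⟨fun i => (1 - s) * x i + s * y i, fun i => add_nonneg
    (mul_nonneg (sub_nonneg.2 s.2.2) (x.2.1 i)) (mul_nonneg s.2.1 (y.2.1 i)), by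
    rw [Finset.sum_add_distrib, ← Finset.mul_sum, ← Finset.mul_sum, sum_eq_one, sum_eq_one]
    ring⟩

section

variable {ι : Type*} [Fintype ι]

lemma segment_apply (x y : stdSimplex ℝ ι) (s : unitInterval) (i : ι) :
    segment x y s i = (1 - s) * x i + s * y i := rfl

lemma segment_self (x : stdSimplex ℝ ι) (s : unitInterval) : segment x x s = x := by
  ext i
  rw [segment_apply]
  ring

lemma segment_zero (x y : stdSimplex ℝ ι) : segment x y 0 = x := by
  ext i
  simp [segment_apply]

lemma segment_one (x y : stdSimplex ℝ ι) : segment x y 1 = y := by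
  ext i
  simp [segment_apply]

lemma continuous_segment :
    Continuous fun p : (stdSimplex ℝ ι × stdSimplex ℝ ι) × unitInterval =>
      segment p.1.1 p.1.2 p.2 := by
  have happ (i : ι) : Continuous fun x : stdSimplex ℝ ι => x i :=
    (_root_.continuous_apply i).comp continuous_subtype_val
  refine Continuous.subtype_mk (continuous_pi fun i => ?_) _
  have h1 := (happ i).comp (continuous_fst.comp
    (continuous_fst (X := stdSimplex ℝ ι × stdSimplex ℝ ι) (Y := unitInterval)))
  have h2 := (happ i).comp (continuous_snd.comp
    (continuous_fst (X := stdSimplex ℝ ι × stdSimplex ℝ ι) (Y := unitInterval)))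
  have h3 := continuous_subtype_val.comp
    (continuous_snd (X := stdSimplex ℝ ι × stdSimplex ℝ ι) (Y := unitInterval))
  exact ((continuous_const.sub h3).mul h1).add (h3.mul h2)

end

/-- The straight line homotopy between a self-map of a simplex and the identity. -/
lemma homotopicRel_comp {ι Y : Type*} [Fintype ι] [TopologicalSpace Y] (f : C(stdSimplex ℝ ι, Y))
    (ρ : C(stdSimplex ℝ ι, stdSimplex ℝ ι)) {S : Set (stdSimplex ℝ ι)} (hρ : ∀ x ∈ S, ρ x = x) :
    f.HomotopicRel (f.comp ρ) S := by
  refine ⟨⟨⟨⟨fun p => f (segment p.2 (ρ p.2) p.1), f.continuous.comp (continuous_segment.comp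
    ((continuous_snd.prodMk (ρ.continuous.comp continuous_snd)).prodMk continuous_fst))⟩,
    fun x => congrArg f (segment_zero _ _), fun x => congrArg f (segment_one _ _)⟩, ?_⟩⟩
  intro s x hx
  change f (segment x (ρ x) s) = f x
  rw [hρ x hx, segment_self]

variable {n : ℕ}

lemma continuous_apply (i : Fin (n + 1)) : Continuous fun x : stdSimplex ℝ (Fin (n + 1)) => x i :=
  (_root_.continuous_apply i).comp continuous_subtype_val

/-- The boundary of the standard simplex. -/
def boundary (n : ℕ) : Set (stdSimplex ℝ (Fin (n + 1))) := {x | ∃ j, x j = 0}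

/-- The smallest coordinate of a point of the simplex. -/
noncomputable def minCoord (x : stdSimplex ℝ (Fin (n + 1))) : ℝ :=
  Finset.univ.inf' Finset.univ_nonempty fun i => x i

lemma continuous_minCoord : Continuous (minCoord (n := n)) :=
  Continuous.finset_inf'_apply _ fun i _ => continuous_apply i

lemma minCoord_le (x : stdSimplex ℝ (Fin (n + 1))) (i : Fin (n + 1)) : minCoord x ≤ x i :=
  Finset.inf'_le _ (Finset.mem_univ i)

lemma exists_eq_minCoord (x : stdSimplex ℝ (Fin (n + 1))) : ∃ i, x i = minCoord x := by
  obtain ⟨i, -, hi⟩ := Finset.exists_mem_eq_inf' (Finset.univ_nonempty (α := Fin (n + 1)))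
    fun i => x i
  exact ⟨i, hi.symm⟩

lemma minCoord_nonneg (x : stdSimplex ℝ (Fin (n + 1))) : 0 ≤ minCoord x := by
  obtain ⟨i, hi⟩ := exists_eq_minCoord x
  exact hi ▸ x.2.1 i

lemma minCoord_eq_zero {x : stdSimplex ℝ (Fin (n + 1))} (hx : x ∈ boundary n) :
    minCoord x = 0 := by
  obtain ⟨j, hj⟩ := hx
  exact le_antisymm (hj ▸ minCoord_le x j) (minCoord_nonneg x)

/-- The denominator in the radial projection of the prism. -/
noncomputable def prismDenom (p : stdSimplex ℝ (Fin (n + 1)) × unitInterval) : ℝ :=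
  max (2 * (1 - (n + 1) * minCoord p.1)) (2 - p.2)

lemma one_le_prismDenom (p : stdSimplex ℝ (Fin (n + 1)) × unitInterval) : 1 ≤ prismDenom p :=
  le_max_of_le_right (by linarith [p.2.2.2])

/-- The radial projection of the prism `T_n × I` onto the union of its sides and its bottom. -/
noncomputable def prismRetraction (n : ℕ) :
    C(stdSimplex ℝ (Fin (n + 1)) × unitInterval, stdSimplex ℝ (Fin (n + 1)) × unitInterval) where
  toFun p :=
    -- Projection from the point (barycentre, 2) above the prism. The factor 2 / d stops the ray at
    -- the side or the bottom, whichever comes first; the smaller factor corresponds to the larger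
    -- d, hence the maximum in `prismDenom`.
    (⟨fun i => 1 / (n + 1 : ℝ) + 2 / prismDenom p * (p.1 i - 1 / (n + 1 : ℝ)), fun i => by
        have hd := one_le_prismDenom p
        have hn : (0 : ℝ) < n + 1 := by positivity
        have h1 : 2 * (1 - (n + 1) * minCoord p.1) ≤ prismDenom p := le_max_left _ _
        have h2 := minCoord_le p.1 i
        have h3 : 1 / (n + 1 : ℝ) + 2 / prismDenom p * (p.1 i - 1 / (n + 1 : ℝ)) =
            (prismDenom p - 2 * (1 - (n + 1) * p.1 i)) / ((n + 1) * prismDenom p) := by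
          have : prismDenom p ≠ 0 := by linarith
          field_simp
          ring
        refine h3.symm.subst (motive := (0 ≤ ·)) (div_nonneg ?_ (by nlinarith))
        nlinarith, by
        have hn : (n + 1 : ℝ) ≠ 0 := by positivity
        rw [Finset.sum_add_distrib, ← Finset.mul_sum, Finset.sum_sub_distrib, sum_eq_one]
        simp [field]⟩,
     ⟨2 - 2 / prismDenom p * (2 - p.2), by
        have hd := one_le_prismDenom p
        have h1 : 2 - (p.2 : ℝ) ≤ prismDenom p := le_max_right _ _
        have hp := p.2.2
        have hm := minCoord_nonneg p.1
        have hn : (0 : ℝ) < n + 1 := by positivity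
        have h2 : prismDenom p ≤ 2 * (2 - p.2) :=
          max_le (by nlinarith [hp.2]) (by linarith [hp.2])
        rw [div_mul_eq_mul_div]
        constructor
        · rw [sub_nonneg, div_le_iff₀ (by linarith)]
          linarith
        · have : 1 ≤ 2 * (2 - (p.2 : ℝ)) / prismDenom p := by
            rw [le_div_iff₀ (by linarith)]
            linarith
          linarith⟩)
  continuous_toFun := by
    have hd : Continuous (prismDenom (n := n)) := by
      have := continuous_minCoord (n := n)
      unfold prismDenom
      fun_prop
    have hq : Continuous fun p => 2 / prismDenom (n := n) p :=
      continuous_const.div hd fun p => by linarith [one_le_prismDenom p]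
    refine Continuous.prodMk (Continuous.subtype_mk (continuous_pi fun i => ?_) _)
      (Continuous.subtype_mk ?_ _)
    · exact continuous_const.add (hq.mul
        (((continuous_apply i).comp continuous_fst).sub continuous_const))
    · exact continuous_const.sub (hq.mul
        (continuous_const.sub (continuous_subtype_val.comp continuous_snd)))

lemma prismRetraction_eq_self {p : stdSimplex ℝ (Fin (n + 1)) × unitInterval}
    (hp : p.1 ∈ boundary n ∨ p.2 = 0) : prismRetraction n p = p := by
  have hd : prismDenom p = 2 := by
    rcases hp with hp | hp
    · rw [prismDenom, minCoord_eq_zero hp]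
      have := p.2.2.1
      rw [max_eq_left] <;> linarith
    · rw [prismDenom, hp]
      have := minCoord_nonneg p.1
      have hn : (0 : ℝ) < n + 1 := by positivity
      rw [max_eq_right]
      · simp
      · simp only [Set.Icc.coe_zero]
        nlinarith
  refine Prod.ext ?_ ?_
  · ext i
    change 1 / (n + 1 : ℝ) + 2 / prismDenom p * (p.1 i - 1 / (n + 1 : ℝ)) = p.1 i
    rw [hd]
    ring
  · apply Subtype.ext
    change 2 - 2 / prismDenom p * (2 - p.2) = (p.2 : ℝ)
    rw [hd]
    ring

/-- The two cases of the maximum: either the smallest coordinate becomes zero, or the height does.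
-/
lemma prismRetraction_mem (p : stdSimplex ℝ (Fin (n + 1)) × unitInterval) :
    (prismRetraction n p).1 ∈ boundary n ∨ (prismRetraction n p).2 = 0 := by
  have hd := one_le_prismDenom p
  have hn : (n + 1 : ℝ) ≠ 0 := by positivity
  rcases max_choice (2 * (1 - (n + 1) * minCoord p.1)) (2 - (p.2 : ℝ)) with h | h
  · left
    obtain ⟨i, hi⟩ := exists_eq_minCoord p.1
    refine ⟨i, ?_⟩
    change 1 / (n + 1 : ℝ) + 2 / prismDenom p * (p.1 i - 1 / (n + 1 : ℝ)) = 0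
    have h1 : prismDenom p = 2 * (1 - (n + 1) * minCoord p.1) := h
    have h2 : p.1 i = (1 - prismDenom p / 2) / (n + 1) := by
      rw [h1, hi]
      field_simp
      ring
    have : prismDenom p ≠ 0 := by linarith
    rw [h2]
    field_simp
    ring
  · right
    apply Subtype.ext
    change 2 - 2 / prismDenom p * (2 - p.2) = 0
    have h1 : prismDenom p = 2 - p.2 := h
    have : 2 - (p.2 : ℝ) ≠ 0 := by linarith [p.2.2.2]
    rw [h1]
    field_simp
    ring

lemma isClosed_boundary_face (j : Fin (n + 1)) :
    IsClosed ({x | x j = 0} : Set (stdSimplex ℝ (Fin (n + 1)))) :=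
  isClosed_eq (continuous_apply j) continuous_const

/-- The homotopy extension property of the pair `(T_n, ∂T_n)`, for a homotopy on the boundary that
is continuous on each face. -/
lemma exists_homotopy_extension {Y : Type*} [TopologicalSpace Y]
    (f : C(stdSimplex ℝ (Fin (n + 1)), Y)) (H : stdSimplex ℝ (Fin (n + 1)) × unitInterval → Y)
    (hH : ∀ j, ContinuousOn H {p | p.1 j = 0}) (hHf : ∀ x ∈ boundary n, H (x, 0) = f x) :
    ∃ G : C(stdSimplex ℝ (Fin (n + 1)) × unitInterval, Y), (∀ x, G (x, 0) = f x) ∧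
      ∀ x ∈ boundary n, ∀ s, G (x, s) = H (x, s) := by
  classical
  -- Away from the sides and the bottom the values of R are arbitrary; the radial projection never
  -- reaches them.
  let R : stdSimplex ℝ (Fin (n + 1)) × unitInterval → Y :=
    fun p => if p.2 = 0 then f p.1 else H p
  have hR (p : stdSimplex ℝ (Fin (n + 1)) × unitInterval) (hp : p.1 ∈ boundary n) :
      R p = H p := by
    simp only [R]
    split_ifs with h
    · rw [← hHf _ hp, ← h]
    · rfl
  let C : Option (Fin (n + 1)) → Set (stdSimplex ℝ (Fin (n + 1)) × unitInterval) :=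
    fun o => o.elim {p | p.2 = 0} fun j => {p | p.1 j = 0}
  have hcont : Continuous fun p => R (prismRetraction n p) := by
    refine continuous_comp_of_closed_cover (C := C) ?_ ?_ (prismRetraction n).continuous ?_
    · rintro (_ | j)
      · exact isClosed_eq continuous_snd continuous_const
      · exact (isClosed_boundary_face j).preimage continuous_fst
    · rintro (_ | j)
      · exact (f.continuous.comp continuous_fst).continuousOn.congr fun p hp => if_pos hp
      · exact (hH j).congr fun p hp => hR p ⟨j, hp⟩
    · intro p
      rcases prismRetraction_mem p with ⟨j, hj⟩ | h
      · exact ⟨some j, hj⟩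
      · exact ⟨none, h⟩
  refine ⟨⟨_, hcont⟩, fun x => ?_, fun x hx s => ?_⟩
  · change R (prismRetraction n (x, 0)) = f x
    rw [prismRetraction_eq_self (Or.inr rfl)]
    exact if_pos rfl
  · change R (prismRetraction n (x, s)) = H (x, s)
    rw [prismRetraction_eq_self (Or.inl hx), hR _ hx]

/-- A function on the horn that is continuous on each face extends to the simplex. -/
lemma exists_horn_extension {Y : Type*} [TopologicalSpace Y] (i : Fin (n + 2))
    (f : stdSimplex ℝ (Fin (n + 2)) → Y) (hf : ∀ j, j ≠ i → ContinuousOn f {x | x j = 0}) :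
    ∃ g : C(stdSimplex ℝ (Fin (n + 2)), Y), ∀ j, j ≠ i → ∀ x, x j = 0 → g x = f x := by
  have hne : ({i}ᶜ : Finset (Fin (n + 2))).Nonempty := by
    obtain ⟨j, hj⟩ := exists_ne i
    exact ⟨j, by simpa using hj⟩
  let c : stdSimplex ℝ (Fin (n + 2)) → ℝ := fun x => ({i}ᶜ : Finset _).inf' hne fun j => x j
  have hc : Continuous c := Continuous.finset_inf'_apply _ fun i _ => continuous_apply i
  have hcle (x) (j) (hj : j ≠ i) : c x ≤ x j := Finset.inf'_le _ (by simpa using hj)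
  have hc0 (x) : 0 ≤ c x := Finset.le_inf' _ _ fun j _ => x.2.1 j
  -- A retraction onto the horn: all n + 2 coordinates are lowered by c, the least one apart from
  -- the i-th, and the lost mass (n + 2) c goes to vertex i.
  let ρ : stdSimplex ℝ (Fin (n + 2)) → stdSimplex ℝ (Fin (n + 2)) := fun x =>
    ⟨fun j => x j - c x + if j = i then (n + 2) * c x else 0, fun j => by
      change 0 ≤ x j - c x + if j = i then (n + 2) * c x else 0
      split_ifs with h
      · have := hc0 x
        have h1 : 0 ≤ x j := x.2.1 j
        have hn : (0 : ℝ) ≤ n := by positivity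
        nlinarith
      · have := hcle x j h
        linarith, by
      simp [Finset.sum_add_distrib]⟩
  have hρ : Continuous ρ := by
    refine Continuous.subtype_mk (continuous_pi fun j => ?_) _
    refine ((continuous_apply j).sub hc).add ?_
    split_ifs <;> fun_prop
  have hcont : Continuous fun x => f (ρ x) := by
    refine continuous_comp_of_closed_cover (ι := {j // j ≠ i}) (C := fun j => {x | x j.1 = 0})
      (fun j => isClosed_boundary_face j.1) (fun j => hf j.1 j.2) hρ fun x => ?_
    obtain ⟨j, hj, h⟩ := Finset.exists_mem_eq_inf' hne fun j => x j
    have hji : j ≠ i := by simpa using hj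
    refine ⟨⟨j, hji⟩, ?_⟩
    change x j - c x + (if j = i then (n + 2) * c x else 0) = 0
    rw [if_neg hji, ← h]
    simp [c]
  refine ⟨⟨_, hcont⟩, fun j hj x hx => ?_⟩
  have h0 : c x = 0 := le_antisymm (hx ▸ hcle x j hj) (hc0 x)
  have : ρ x = x := by
    ext k
    change x k - c x + (if k = i then (n + 2) * c x else 0) = x k
    simp [h0]
  change f (ρ x) = f x
  rw [this]

end stdSimplex

/-! ### Continuous extension from T_n and the hyperplanes to A_n. -/

namespace AffineSimplex

variable {n : ℕ}

/-- The smallest modulus of a coordinate. -/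
noncomputable def minNorm (t : AffineSimplex n) : ℝ :=
  Finset.univ.inf' Finset.univ_nonempty fun i => ‖t.1 i‖

/-- The sum of the moduli of the coordinates. -/
noncomputable def sumNorm (t : AffineSimplex n) : ℝ := ∑ i, ‖t.1 i‖

lemma continuous_minNorm : Continuous (minNorm (n := n)) :=
  Continuous.finset_inf'_apply _ fun i _ => (continuous_apply i).norm

lemma continuous_sumNorm : Continuous (sumNorm (n := n)) :=
  continuous_finsetSum _ fun i _ => (continuous_apply i).norm

lemma minNorm_le (t : AffineSimplex n) (i : Fin (n + 1)) : minNorm t ≤ ‖t.1 i‖ :=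
  Finset.inf'_le _ (Finset.mem_univ i)

lemma exists_norm_eq_minNorm (t : AffineSimplex n) : ∃ i, ‖t.1 i‖ = minNorm t := by
  obtain ⟨i, -, hi⟩ := Finset.exists_mem_eq_inf' (Finset.univ_nonempty (α := Fin (n + 1)))
    fun i => ‖t.1 i‖
  exact ⟨i, hi.symm⟩

lemma minNorm_nonneg (t : AffineSimplex n) : 0 ≤ minNorm t :=
  Finset.le_inf' _ _ fun _ _ => norm_nonneg _

lemma minNorm_eq_zero {t : AffineSimplex n} (ht : t ∈ boundary n) : minNorm t = 0 := by
  obtain ⟨j, hj⟩ := ht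
  exact le_antisymm ((minNorm_le t j).trans (by simp [hj])) (minNorm_nonneg t)

lemma one_le_sumNorm (t : AffineSimplex n) : 1 ≤ sumNorm t := by
  have := norm_sum_le Finset.univ t.1
  rwa [t.2, norm_one] at this

lemma mul_minNorm_le (t : AffineSimplex n) : (n + 1) * minNorm t ≤ sumNorm t := by
  have := Finset.card_nsmul_le_sum Finset.univ (fun i => ‖t.1 i‖) _ fun i _ => minNorm_le t i
  simpa [sumNorm] using this

/-- A scale invariant distance to the coordinate hyperplanes. -/
noncomputable def depth (t : AffineSimplex n) : ℝ := (n + 1) * minNorm t / sumNorm t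

lemma continuous_depth : Continuous (depth (n := n)) :=
  (continuous_const.mul continuous_minNorm).div continuous_sumNorm
    fun t => by linarith [one_le_sumNorm t]

lemma depth_le_one (t : AffineSimplex n) : depth t ≤ 1 := by
  rw [depth, div_le_one (by linarith [one_le_sumNorm t])]
  exact mul_minNorm_le t

/-- The amount subtracted from the moduli of the coordinates in the retraction. -/
noncomputable def threshold (t : AffineSimplex n) : ℝ := minNorm t * min 1 (2 * (1 - depth t))

lemma continuous_threshold : Continuous (threshold (n := n)) :=
  continuous_minNorm.mul (continuous_const.min
    (continuous_const.mul (continuous_const.sub continuous_depth)))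

lemma threshold_le (t : AffineSimplex n) : threshold t ≤ minNorm t :=
  mul_le_of_le_one_right (minNorm_nonneg t) (min_le_left _ _)

/-- Subtracting the full `minNorm` would leave nothing when all moduli are equal. This is the case
`depth t = 1`, and there the cut-off in `threshold` makes it vanish. -/
lemma sumNorm_sub_pos (t : AffineSimplex n) : 0 < sumNorm t - (n + 1) * threshold t := by
  have h1 := one_le_sumNorm t
  rcases (depth_le_one t).lt_or_eq with h | h
  · rw [depth, div_lt_one (by linarith)] at h
    have hn : (0 : ℝ) < n + 1 := by positivity
    have := mul_le_mul_of_nonneg_left (threshold_le t) hn.le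
    linarith
  · have : threshold t = 0 := by simp [threshold, h]
    rw [this]
    linarith

/-- The point of the standard simplex obtained by lowering the moduli of the coordinates. -/
noncomputable def lower (t : AffineSimplex n) : stdSimplex ℝ (Fin (n + 1)) :=
  ⟨fun j => (‖t.1 j‖ - threshold t) / (sumNorm t - (n + 1) * threshold t),
    fun j => div_nonneg (sub_nonneg.2 ((threshold_le t).trans (minNorm_le t j)))
      (sumNorm_sub_pos t).le, by
    rw [← Finset.sum_div, Finset.sum_sub_distrib]
    simp only [Finset.sum_const, Finset.card_univ, Fintype.card_fin, nsmul_eq_mul, Nat.cast_add,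
      Nat.cast_one]
    exact div_self (sumNorm_sub_pos t).ne'⟩

lemma continuous_lower : Continuous (lower (n := n)) :=
  Continuous.subtype_mk (continuous_pi fun j =>
    ((continuous_apply j).norm.sub continuous_threshold).div
      (continuous_sumNorm.sub (continuous_const.mul continuous_threshold))
      fun t => (sumNorm_sub_pos t).ne') _

/-- The coordinates with moduli lowered by the smallest modulus, multiplied by a cut-off. -/
noncomputable def shrink (t : AffineSimplex n) (j : Fin (n + 1)) : ℂ :=
  -- The phases are kept. The cut-off is 1 on the hyperplanes, where the depth is 0, and vanishes
  -- from depth 1/2 on.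
  (max 0 (1 - 2 * depth t) : ℝ) * (t.1 j - minNorm t * (t.1 j / ‖t.1 j‖))

/-- The phase is discontinuous where the j-th coordinate vanishes, but its factor `minNorm` tends to
zero there. -/
lemma continuous_shrink (j : Fin (n + 1)) : Continuous fun t : AffineSimplex n => shrink t j := by
  refine (Complex.continuous_ofReal.comp (continuous_const.max
    (continuous_const.sub (continuous_const.mul continuous_depth)))).mul
    ((continuous_apply j).sub ?_)
  rw [continuous_iff_continuousAt]
  intro t
  by_cases h : t.1 j = 0
  · have h0 : minNorm t = 0 := minNorm_eq_zero ⟨j, h⟩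
    have hb (s : AffineSimplex n) : ‖(minNorm s : ℂ) * (s.1 j / ‖s.1 j‖)‖ ≤ minNorm s := by
      rw [norm_mul, norm_div, Complex.norm_real, Complex.norm_real, Real.norm_of_nonneg
        (minNorm_nonneg s), norm_norm]
      exact mul_le_of_le_one_right (minNorm_nonneg s) (div_self_le_one _)
    have : Filter.Tendsto (fun s : AffineSimplex n => (minNorm s : ℂ) * (s.1 j / ‖s.1 j‖)) (𝓝 t)
        (𝓝 0) :=
      squeeze_zero_norm hb (by simpa [h0] using continuous_minNorm.tendsto t)
    rw [ContinuousAt]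
    simpa [h0] using this
  · have h1 : (‖t.1 j‖ : ℂ) ≠ 0 := by simpa using h
    exact (Complex.continuous_ofReal.comp continuous_minNorm).continuousAt.mul
      ((continuous_apply j).continuousAt.div
        (Complex.continuous_ofReal.comp (continuous_apply j).norm).continuousAt h1)

/-- A map from the affine simplex to the union of the standard simplex and the coordinate
hyperplanes that is the identity on the hyperplanes and preserves the standard simplex. -/
noncomputable def retraction (n : ℕ) : C(AffineSimplex n, AffineSimplex n) where
  toFun t := ⟨fun j => shrink t j + (1 - ∑ i, shrink t i) * (lower t j : ℝ), by
    rw [Finset.sum_add_distrib, ← Finset.mul_sum, ← Complex.ofReal_sum, stdSimplex.sum_eq_one]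
    simp⟩
  continuous_toFun := by
    refine Continuous.subtype_mk (continuous_pi fun j => ?_) _
    have h1 := continuous_shrink j
    have h2 : Continuous fun t : AffineSimplex n => ∑ i, shrink t i :=
      continuous_finsetSum _ fun i _ => continuous_shrink i
    have h3 := (stdSimplex.continuous_apply j).comp (continuous_lower (n := n))
    exact h1.add ((continuous_const.sub h2).mul (Complex.continuous_ofReal.comp h3))

lemma retraction_apply (t : AffineSimplex n) (j : Fin (n + 1)) :
    (retraction n t).1 j = shrink t j + (1 - ∑ i, shrink t i) * (lower t j : ℝ) := rfl

lemma retraction_eq_self {t : AffineSimplex n} (ht : t ∈ boundary n) : retraction n t = t := by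
  have h (j) : shrink t j = t.1 j := by simp [shrink, depth, minNorm_eq_zero ht]
  apply Subtype.ext
  funext j
  rw [retraction_apply, h, Finset.sum_congr rfl fun i _ => h i, t.2]
  simp

/-- At depth at most 1/2 the coordinate of least modulus is killed in both summands; at depth at
least 1/2 `shrink` vanishes and only `lower t` remains. -/
lemma retraction_mem (t : AffineSimplex n) :
    retraction n t ∈ boundary n ∨ retraction n t ∈ Set.range (ofStdSimplex n) := by
  rcases le_total (depth t) (1 / 2) with h | h
  · left
    obtain ⟨j, hj⟩ := exists_norm_eq_minNorm t
    refine ⟨j, ?_⟩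
    have h1 : threshold t = minNorm t := by
      rw [threshold, min_eq_left (by linarith), mul_one]
    have h2 : lower t j = 0 := by
      change (‖t.1 j‖ - threshold t) / _ = 0
      rw [h1, hj, sub_self, zero_div]
    have h3 : shrink t j = 0 := by
      rw [shrink, ← hj]
      by_cases h0 : t.1 j = 0
      · simp [h0]
      · have : (‖t.1 j‖ : ℂ) ≠ 0 := by simpa using h0
        rw [mul_div_cancel₀ _ this, sub_self, mul_zero]
    rw [retraction_apply, h2, h3]
    simp
  · right
    have h1 (j) : shrink t j = 0 := by
      rw [shrink, max_eq_left (by linarith)]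
      simp
    refine ⟨lower t, ?_⟩
    apply Subtype.ext
    funext j
    rw [retraction_apply]
    simp only [h1, Finset.sum_const_zero]
    simp only [zero_add, sub_zero, one_mul]
    rfl

/-- On T_n the coordinates are their own moduli, so both summands are real and nonnegative. The
self-map of T_n obtained need not be the identity, but a straight line homotopy joins it to the
identity. -/
lemma retraction_ofStdSimplex (x : stdSimplex ℝ (Fin (n + 1))) :
    ∃ y, ofStdSimplex n y = retraction n (ofStdSimplex n x) := by
  set t := ofStdSimplex n x
  have hn (j) : ‖t.1 j‖ = x j := by
    exact (Complex.norm_real _).trans (Real.norm_of_nonneg (x.2.1 j))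
  set β : ℝ := max 0 (1 - 2 * depth t)
  have hβ0 : 0 ≤ β := le_max_left _ _
  have hm := minNorm_nonneg t
  have hβ1 : β ≤ 1 := by
    refine max_le zero_le_one ?_
    have : 0 ≤ depth t := div_nonneg (by positivity) (by linarith [one_le_sumNorm t])
    linarith
  have hw (j) : shrink t j = ((β * (x j - minNorm t) : ℝ) : ℂ) := by
    rw [shrink, hn j]
    have htj : t.1 j = ((x j : ℝ) : ℂ) := rfl
    rw [htj]
    push_cast
    congr 2
    by_cases h0 : x j = 0
    · have : minNorm t = 0 := minNorm_eq_zero ⟨j, by rw [htj, h0]; simp⟩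
      simp [this]
    · have : ((x j : ℝ) : ℂ) ≠ 0 := by exact_mod_cast h0
      rw [div_self this, mul_one]
  have hle (j) : minNorm t ≤ x j := hn j ▸ minNorm_le t j
  have hsum : ∑ j, β * (x j - minNorm t) = β * (1 - (n + 1) * minNorm t) := by
    rw [← Finset.mul_sum, Finset.sum_sub_distrib, stdSimplex.sum_eq_one]
    simp
  have hs1 : β * (1 - (n + 1) * minNorm t) ≤ 1 := by
    have : 1 - (n + 1) * minNorm t ≤ 1 := by
      have : 0 ≤ (n + 1) * minNorm t := by positivity
      linarith
    calc β * (1 - (n + 1) * minNorm t) ≤ β * 1 := mul_le_mul_of_nonneg_left this hβ0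
      _ ≤ 1 := by linarith
  refine ⟨⟨fun j => β * (x j - minNorm t) + (1 - β * (1 - (n + 1) * minNorm t)) * lower t j,
    fun j => add_nonneg (mul_nonneg hβ0 (sub_nonneg.2 (hle j)))
      (mul_nonneg (sub_nonneg.2 hs1) ((lower t).2.1 j)), ?_⟩, ?_⟩
  · rw [Finset.sum_add_distrib, hsum, ← Finset.mul_sum, stdSimplex.sum_eq_one]
    ring
  · apply Subtype.ext
    funext j
    have hS : ∑ i, shrink t i = ((β * (1 - (n + 1) * minNorm t) : ℝ) : ℂ) := by
      rw [Finset.sum_congr rfl fun i _ => hw i, ← Complex.ofReal_sum, hsum]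
    refine Eq.trans ?_ (retraction_apply t j).symm
    rw [hS, hw]
    change ((β * (x j - minNorm t) + (1 - β * (1 - (n + 1) * minNorm t)) * lower t j : ℝ) : ℂ) = _
    push_cast
    rfl

lemma isClosedEmbedding_ofStdSimplex (n : ℕ) :
    Topology.IsClosedEmbedding (ofStdSimplex n) :=
  (ofStdSimplex n).continuous.isClosedEmbedding fun x y h => by
    ext i
    exact Complex.ofReal_injective (congrFun (congrArg Subtype.val h) i)

lemma ofStdSimplex_apply_eq_zero {x : stdSimplex ℝ (Fin (n + 1))} {j : Fin (n + 1)} :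
    (ofStdSimplex n x).1 j = 0 ↔ x j = 0 := Complex.ofReal_eq_zero

/-- Continuous maps on the standard simplex and on the coordinate hyperplanes of the affine simplex
that agree on the boundary of the standard simplex extend to the affine simplex, up to a homotopy
on the standard simplex. -/
lemma exists_continuous_extension {Y : Type*} [TopologicalSpace Y]
    (f : C(stdSimplex ℝ (Fin (n + 1)), Y)) (g : AffineSimplex n → Y)
    (hg : ∀ j, ContinuousOn g {t | t.1 j = 0})
    (hfg : ∀ x ∈ stdSimplex.boundary n, g (ofStdSimplex n x) = f x) :
    ∃ φ : C(AffineSimplex n, Y), (∀ t ∈ boundary n, φ t = g t) ∧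
      f.HomotopicRel (φ.comp (ofStdSimplex n)) (stdSimplex.boundary n) := by
  classical
  have hemb := isClosedEmbedding_ofStdSimplex n
  -- Thus f is used on T_n and g on the hyperplanes; they agree on the overlap, and other points are
  -- not in the image of `retraction`.
  let R : AffineSimplex n → Y := fun t => if h : ∃ x, ofStdSimplex n x = t then f h.choose else g t
  have hRf (x) : R (ofStdSimplex n x) = f x := by
    have h : ∃ y, ofStdSimplex n y = ofStdSimplex n x := ⟨x, rfl⟩
    simp only [R, dif_pos h]
    rw [hemb.injective h.choose_spec]
  have hRg (t) (ht : t ∈ boundary n) : R t = g t := by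
    by_cases h : ∃ x, ofStdSimplex n x = t
    · obtain ⟨x, rfl⟩ := h
      obtain ⟨j, hj⟩ := ht
      rw [hRf, hfg x ⟨j, ofStdSimplex_apply_eq_zero.1 hj⟩]
    · simp only [R, dif_neg h]
  let C : Option (Fin (n + 1)) → Set (AffineSimplex n) :=
    fun o => o.elim (Set.range (ofStdSimplex n)) fun j => {t | t.1 j = 0}
  have hcont : Continuous fun t => R (retraction n t) := by
    refine continuous_comp_of_closed_cover (C := C) ?_ ?_ (retraction n).continuous ?_
    · rintro (_ | j)
      · exact hemb.isClosed_range
      · exact isClosed_eq (continuous_apply j) continuous_const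
    · rintro (_ | j)
      · have h1 : Topology.IsQuotientMap (Set.rangeFactorization (ofStdSimplex n)) :=
          (hemb.isEmbedding.toHomeomorph).isQuotientMap
        change ContinuousOn R (Set.range (ofStdSimplex n))
        rw [continuousOn_iff_continuous_domRestrict, h1.continuous_iff]
        exact f.continuous.congr fun x => (hRf x).symm
      · exact (hg j).congr fun t ht => hRg t ⟨j, ht⟩
    · intro t
      rcases retraction_mem t with ⟨j, hj⟩ | h
      · exact ⟨some j, hj⟩
      · exact ⟨none, h⟩
  refine ⟨⟨_, hcont⟩, fun t ht => ?_, ?_⟩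
  · change R (retraction n t) = g t
    rw [retraction_eq_self ht, hRg t ht]
  · choose ρ hρ using retraction_ofStdSimplex (n := n)
    have hρc : Continuous ρ := by
      rw [hemb.isInducing.continuous_iff]
      exact ((retraction n).continuous.comp (ofStdSimplex n).continuous).congr fun x => (hρ x).symm
    have h := stdSimplex.homotopicRel_comp f ⟨ρ, hρc⟩ (S := stdSimplex.boundary n) ?_
    · convert h using 1
      ext x
      change R (retraction n (ofStdSimplex n x)) = f (ρ x)
      rw [← hρ, hRf]
    · rintro x ⟨j, hj⟩
      apply hemb.injective
      change ofStdSimplex n (ρ x) = _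
      rw [hρ, retraction_eq_self ⟨j, ofStdSimplex_apply_eq_zero.2 hj⟩]

end AffineSimplex

/-! ### Holomorphic filling of a simplex relative to its boundary. -/

lemma ContinuousMap.HomotopicRel.comp_right {A B Y : Type*} [TopologicalSpace A]
    [TopologicalSpace B] [TopologicalSpace Y] {f g : C(B, Y)} {S : Set B} (h : f.HomotopicRel g S)
    (k : C(A, B)) {S' : Set A} (hk : Set.MapsTo k S' S) :
    (f.comp k).HomotopicRel (g.comp k) S' := by
  obtain ⟨L⟩ := h
  refine ⟨⟨⟨⟨fun p => L (p.1, k p.2), by fun_prop⟩, fun x => ?_, fun x => ?_⟩, ?_⟩⟩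
  · exact L.apply_zero (k x)
  · exact L.apply_one (k x)
  · exact fun s x hx => L.eq_fst s (hk hx)

section Filling

variable {F : Type v} [NormedAddCommGroup F] [NormedSpace ℂ F]
variable {X : Type u} [TopologicalSpace X] [ChartedSpace F X] [IsManifold 𝓘(ℂ, F) ω X]

open AffineSimplex in
/-- On an Oka manifold, a map `f` on `T_n`, holomorphic maps on the faces of `A_n` and a homotopy
between them on the boundary of `T_n` extend to a holomorphic map on `A_n` and a homotopy. -/
theorem exists_filling (hX : IsOka F X) {n : ℕ} (f : C(stdSimplex ℝ (Fin (n + 1)), X))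
    (g : AffineSimplex n → X)
    (hg : ∀ j, ∃ k : AffineSimplex n → X, ContMDiff 𝓘(ℂ, Fin n → ℂ) 𝓘(ℂ, F) ω k ∧
      ∀ t : AffineSimplex n, t.1 j = 0 → g t = k t)
    (H : stdSimplex ℝ (Fin (n + 1)) × unitInterval → X)
    (hH : ∀ j, ContinuousOn H {p | p.1 j = 0})
    (hHf : ∀ x ∈ stdSimplex.boundary n, H (x, 0) = f x)
    (hHg : ∃ ε : ℝ, 0 < ε ∧ ∀ x ∈ stdSimplex.boundary n, ∀ s : unitInterval,
      1 - ε ≤ s → H (x, s) = g (ofStdSimplex n x)) :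
    ∃ (G : AffineSimplex n → X) (K : C(stdSimplex ℝ (Fin (n + 1)) × unitInterval, X)),
      ContMDiff 𝓘(ℂ, Fin n → ℂ) 𝓘(ℂ, F) ω G ∧ (∀ t ∈ boundary n, G t = g t) ∧
      (∀ x ∈ stdSimplex.boundary n, ∀ s, K (x, s) = H (x, s)) ∧ (∀ x, K (x, 0) = f x) ∧
      ∃ ε : ℝ, 0 < ε ∧ ∀ x, ∀ s : unitInterval, 1 - ε ≤ s → K (x, s) = G (ofStdSimplex n x) := by
  obtain ⟨K₁, hK₁f, hK₁H⟩ := stdSimplex.exists_homotopy_extension f H hH hHf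
  obtain ⟨ε, hε, hε1, hHg⟩ : ∃ ε : ℝ, 0 < ε ∧ ε ≤ 1 ∧ ∀ x ∈ stdSimplex.boundary n,
      ∀ s : unitInterval, 1 - ε ≤ s → H (x, s) = g (ofStdSimplex n x) := by
    obtain ⟨ε, hε, h⟩ := hHg
    exact ⟨min ε 1, lt_min hε one_pos, min_le_right _ _, fun x hx s hs =>
      h x hx s (by linarith [min_le_left ε 1])⟩
  -- From this time on the homotopy on the boundary is stationary, so the remaining time is free for
  -- deformations relative to the boundary. This is why homotopies are required to be stationary
  -- near the end.
  let a : unitInterval := ⟨1 - ε, by linarith, by linarith⟩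
  let f₁ : C(stdSimplex ℝ (Fin (n + 1)), X) := ⟨fun x => K₁ (x, a), by fun_prop⟩
  have hf₁ (x) (hx : x ∈ stdSimplex.boundary n) : g (ofStdSimplex n x) = f₁ x := by
    change _ = K₁ (x, a)
    rw [hK₁H x hx, hHg x hx a le_rfl]
  choose k hk hgk using hg
  obtain ⟨φ, hφg, hφf⟩ := exists_continuous_extension f₁ g
    (fun j => (hk j).continuous.continuousOn.congr fun t ht => hgk j t ht) hf₁
  obtain ⟨G, hG, hφG⟩ := exists_homotopicRel_of_isOka hX φ k hk
    fun j t ht => (hφg t ⟨j, ht⟩).trans (hgk j t ht)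
  -- L joins `f₁` to the restriction of G: first the topological extension, then the Oka
  -- deformation, both fixed on ∂T_n.
  obtain ⟨L⟩ := hφf.trans (hφG.comp_right (ofStdSimplex n) (S' := stdSimplex.boundary n)
    fun x ⟨j, hj⟩ => ⟨j, ofStdSimplex_apply_eq_zero.2 hj⟩)
  -- L runs during [1 - ε, 1 - ε/2], which leaves [1 - ε/2, 1] as a new stationary interval.
  let τ : unitInterval → unitInterval := fun s =>
    Set.projIcc 0 1 zero_le_one ((s - (1 - ε)) / (ε / 2))
  have hτ : Continuous τ := continuous_projIcc.comp (by fun_prop)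
  have hτ0 (s : unitInterval) (hs : (s : ℝ) = 1 - ε) : τ s = 0 := by
    simp only [τ, hs, sub_self, zero_div]
    exact Set.projIcc_left (zero_le_one' ℝ)
  have hτ1 (s : unitInterval) (hs : 1 - ε / 2 ≤ (s : ℝ)) : τ s = 1 := by
    refine Set.projIcc_of_right_le _ ?_
    rw [le_div_iff₀ (by linarith)]
    linarith
  let K : stdSimplex ℝ (Fin (n + 1)) × unitInterval → X := fun p =>
    if (p.2 : ℝ) ≤ 1 - ε then K₁ p else L (τ p.2, p.1)
  have hK : Continuous K := by
    refine Continuous.if_le K₁.continuous (L.continuous.comp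
      ((hτ.comp continuous_snd).prodMk continuous_fst))
      (continuous_subtype_val.comp continuous_snd) continuous_const fun p hp => ?_
    rw [hτ0 p.2 hp, L.apply_zero]
    change K₁ p = K₁ (p.1, a)
    congr 1
    exact Prod.ext rfl (Subtype.ext hp)
  refine ⟨G, ⟨K, hK⟩, hG, fun t ht => ?_, fun x hx s => ?_, fun x => ?_, ε / 2, by linarith,
    fun x s hs => ?_⟩
  · exact (hφG.some.fst_eq_snd ht).symm.trans (hφg t ht)
  · change (if (s : ℝ) ≤ 1 - ε then K₁ (x, s) else L (τ s, x)) = H (x, s)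
    split_ifs with hs
    · exact hK₁H x hx s
    · rw [L.eq_fst _ hx, ← hf₁ x hx, hHg x hx s (by linarith)]
  · change (if (0 : ℝ) ≤ 1 - ε then K₁ (x, 0) else L (τ 0, x)) = f x
    rw [if_pos (by linarith), hK₁f]
  · change (if (s : ℝ) ≤ 1 - ε then K₁ (x, s) else L (τ s, x)) = G (ofStdSimplex n x)
    rw [if_neg (by linarith), hτ1 s hs, L.apply_one]
    rfl

end Filling

/-! ### Gluing functions along the faces of a simplex. -/

/-- A nonempty subset of a finite ordinal is the image of a monotone retraction. -/
lemma Fin.exists_monotone_retraction {n : ℕ} (S : Set (Fin (n + 1))) (hS : S.Nonempty) :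
    ∃ π : Fin (n + 1) →o Fin (n + 1), (∀ i, π i ∈ S) ∧ ∀ i ∈ S, π i = i := by
  classical
  obtain ⟨a, ha, hmin⟩ := S.toFinite.exists_minimal hS
  have hle (i) (hi : i ∈ S) : a ≤ i := (le_total a i).elim id fun h => hmin hi h
  -- The retraction takes i to the largest element of S below or equal to i, or to the least element
  -- a of S if there is none.
  let T (i : Fin (n + 1)) : Finset (Fin (n + 1)) := {k | k = a ∨ k ∈ S ∧ k ≤ i}
  have hT (i) : (T i).Nonempty := ⟨a, by simp [T]⟩
  refine ⟨⟨fun i => (T i).max' (hT i), fun i j hij => ?_⟩, fun i => ?_, fun i hi => ?_⟩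
  · refine Finset.max'_subset _ fun k hk => ?_
    simp only [T, Finset.mem_filter, Finset.mem_univ, true_and] at hk ⊢
    exact hk.imp_right fun h => ⟨h.1, h.2.trans hij⟩
  · have := (T i).max'_mem (hT i)
    simp only [T, Finset.mem_filter, Finset.mem_univ, true_and] at this
    rcases this with h | h
    · change (T i).max' (hT i) ∈ S
      rw [h]
      exact ha
    · exact h.1
  · refine le_antisymm (Finset.max'_le _ (hT i) _ fun k hk => ?_) (Finset.le_max' _ _ ?_)
    · simp only [T, Finset.mem_filter, Finset.mem_univ, true_and] at hk
      exact hk.elim (fun h => h ▸ hle i hi) And.right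
    · simp [T, hi]

namespace SSet

/-- A morphism from a subcomplex of `Δ[n]` defines a function on the union of the corresponding
faces of a space `W` of points with supports in `Fin (n + 1)`. -/
lemma exists_glue {K : SSet.{u}} {n : ℕ} {A : (Δ[n] : SSet.{u}).Subcomplex} (b : (A : SSet) ⟶ K)
    {W Y : Type*} (y₀ : Y) (supp : W → Set (Fin (n + 1))) (hsupp : ∀ w, (supp w).Nonempty)
    (ev : K.obj (op ⦋n⦌) → W → Y)
    (hev : ∀ κ (π : Fin (n + 1) →o Fin (n + 1)) w, (∀ i ∈ supp w, π i = i) →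
      ev (K.map (SimplexCategory.mkHom π).op κ) w = ev κ w) :
    ∃ G : W → Y, ∀ (α : (A : SSet).obj (op ⦋n⦌)) (w : W),
      (∀ i ∈ supp w, (show Δ[n].obj (op ⦋n⦌) from α.1) i = i) → G w = ev (b.app _ α) w := by
  classical
  let fixes (α : (A : SSet).obj (op ⦋n⦌)) (w : W) : Prop :=
    ∀ i ∈ supp w, (show Δ[n].obj (op ⦋n⦌) from α.1) i = i
  have key (α β : (A : SSet).obj (op ⦋n⦌)) (w : W) (hα : fixes α w) (hβ : fixes β w) :
      ev (b.app _ α) w = ev (b.app _ β) w := by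
    -- Faces are represented by self-maps of [n]. If α and β both fix the support of w, then α ∘ π =
    -- β ∘ π for a retraction π onto the support, and passing to π does not change the value at w.
    obtain ⟨π, hπ, hπi⟩ := Fin.exists_monotone_retraction (supp w) (hsupp w)
    rw [← hev _ π w hπi, ← hev (b.app _ β) π w hπi, ← NatTrans.naturality_apply,
      ← NatTrans.naturality_apply]
    congr 2
    apply Subtype.ext
    refine stdSimplex.ext _ _ fun i => ?_
    exact (hα _ (hπ i)).trans (hβ _ (hπ i)).symm
  -- The value `y₀` is used only at points on no face of A.
  refine ⟨fun w => if h : ∃ α, fixes α w then ev (b.app _ h.choose) w else y₀, fun α w hα => ?_⟩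
  have h : ∃ α, fixes α w := ⟨α, hα⟩
  simp only [dif_pos h]
  exact key _ _ w h.choose_spec hα

end SSet

lemma AffineSimplex.exists_ne_zero {n : ℕ} (t : AffineSimplex n) : ∃ i, t.1 i ≠ 0 := by
  by_contra! h
  simpa [h] using t.2

namespace stdSimplex

lemma exists_ne_zero {n : ℕ} (x : stdSimplex ℝ (Fin (n + 1))) : ∃ i, x i ≠ 0 := by
  by_contra! h
  simpa [h] using sum_eq_one x

lemma map_apply {ι κ : Type*} [Fintype ι] [Fintype κ] [DecidableEq κ] (θ : ι → κ)
    (x : stdSimplex ℝ ι) (i : κ) : map θ x i = ∑ j with θ j = i, x j := by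
  rw [map_coe, FunOnFinite.linearMap_apply_apply]

lemma map_segment {ι κ : Type*} [Fintype ι] [Fintype κ] (θ : ι → κ) (x y : stdSimplex ℝ ι) (s : unitInterval) :
    map θ (segment x y s) = segment (map θ x) (map θ y) s := by
  classical
  ext k
  simp only [map_apply, segment_apply, Finset.sum_add_distrib, Finset.mul_sum]

lemma map_eq_self {n : ℕ} {θ : Fin (n + 1) → Fin (n + 1)} {x : stdSimplex ℝ (Fin (n + 1))}
    (h : ∀ i, x i ≠ 0 → θ i = i) : map θ x = x := by
  apply (AffineSimplex.isClosedEmbedding_ofStdSimplex n).injective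
  rw [← AffineSimplex.map_ofStdSimplex, AffineSimplex.map_eq_self]
  exact fun i hi => h i fun h0 => hi (AffineSimplex.ofStdSimplex_apply_eq_zero.2 h0)

end stdSimplex

/-! ### The simplicial set of homotopies with holomorphic ends. -/

section HolomorphicPaths

variable (F : Type v) [NormedAddCommGroup F] [NormedSpace ℂ F]
variable (X : Type u) [TopologicalSpace X] [ChartedSpace F X]

/-- A homotopy `T_n × I → X` that is stationary near the end, together with an extension of the
final map to a holomorphic map `A_n → X`. -/
@[ext]
structure HolomorphicPath (n : ℕ) where
  /-- The homotopy. -/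
  path : C(stdSimplex ℝ (Fin (n + 1)) × unitInterval, X)
  /-- The final holomorphic map. -/
  final : AffineSimplex n → X
  contMDiff_final : ContMDiff 𝓘(ℂ, Fin n → ℂ) 𝓘(ℂ, F) ω final
  stationary : ∃ ε : ℝ, 0 < ε ∧ ∀ x, ∀ s : unitInterval, 1 - ε ≤ s →
    path (x, s) = final (AffineSimplex.ofStdSimplex n x)

variable {F X} in
/-- The restriction of a homotopy along a map of simplices. -/
noncomputable def HolomorphicPath.comp {n m : ℕ} (p : HolomorphicPath F X m)
    (θ : Fin (n + 1) → Fin (m + 1)) : HolomorphicPath F X n where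
  path := p.path.comp ((⟨stdSimplex.map θ, stdSimplex.continuous_map _⟩ :
    C(_, _)).prodMap (ContinuousMap.id _))
  final := p.final ∘ AffineSimplex.map θ
  contMDiff_final := p.contMDiff_final.comp (AffineSimplex.contMDiff_map θ)
  stationary := by
    obtain ⟨ε, hε, h⟩ := p.stationary
    exact ⟨ε, hε, fun x s hs => (h _ s hs).trans
      (congrArg p.final (AffineSimplex.map_ofStdSimplex _ x).symm)⟩

variable {F X} in
lemma HolomorphicPath.comp_id {n : ℕ} (p : HolomorphicPath F X n) : p.comp id = p := by
  refine HolomorphicPath.ext ?_ ?_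
  · ext ⟨x, s⟩
    exact congrArg (fun y => p.path (y, s)) (stdSimplex.map_id_apply x)
  · funext t
    exact congrArg p.final (AffineSimplex.map_id t)

variable {F X} in
lemma HolomorphicPath.comp_comp {n m k : ℕ} (p : HolomorphicPath F X k)
    (θ : Fin (n + 1) → Fin (m + 1)) (η : Fin (m + 1) → Fin (k + 1)) :
    (p.comp η).comp θ = p.comp (η ∘ θ) := by
  refine HolomorphicPath.ext ?_ ?_
  · ext ⟨x, s⟩
    exact congrArg (fun y => p.path (y, s)) (stdSimplex.map_comp_apply θ η x)
  · funext t
    exact congrArg p.final (AffineSimplex.map_comp θ η t)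

variable {F X} in
/-- The constant homotopy at a holomorphic map. -/
noncomputable def HolomorphicPath.const {n : ℕ} (g : AffineSimplex n → X)
    (hg : ContMDiff 𝓘(ℂ, Fin n → ℂ) 𝓘(ℂ, F) ω g) : HolomorphicPath F X n where
  path := ⟨fun p => g (AffineSimplex.ofStdSimplex _ p.1), hg.continuous.comp (by fun_prop)⟩
  final := g
  contMDiff_final := hg
  stationary := ⟨1, one_pos, fun _ _ _ => rfl⟩

variable {F X} in
lemma HolomorphicPath.const_comp {n m : ℕ} (g : AffineSimplex m → X)
    (hg : ContMDiff 𝓘(ℂ, Fin m → ℂ) 𝓘(ℂ, F) ω g) (θ : Fin (n + 1) → Fin (m + 1)) :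
    (HolomorphicPath.const g hg).comp θ =
      HolomorphicPath.const (g ∘ AffineSimplex.map θ)
        (hg.comp (AffineSimplex.contMDiff_map θ)) := by
  refine HolomorphicPath.ext ?_ rfl
  ext ⟨x, s⟩
  exact congrArg g (AffineSimplex.map_ofStdSimplex θ x).symm

/-- The simplicial set of homotopies in `X` with holomorphic final maps. -/
noncomputable def holomorphicPathSet : SSet.{u} where
  obj n := HolomorphicPath F X n.unop.len
  map θ := ↾fun p => p.comp θ.unop.toOrderHom
  map_id _ := ConcreteCategory.hom_ext _ _ fun p => HolomorphicPath.comp_id p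
  map_comp θ η := ConcreteCategory.hom_ext _ _ fun p =>
    (HolomorphicPath.comp_comp p η.unop.toOrderHom θ.unop.toOrderHom).symm

namespace holomorphicPathSet

/-- The initial map of a homotopy. -/
noncomputable def source : holomorphicPathSet F X ⟶ TopCat.toSSet.obj (TopCat.of X) where
  app n := ↾fun p => ((TopCat.of X).toSSetObjEquiv n).symm ⟨fun x => p.path (x, 0), by fun_prop⟩
  naturality n m θ := by
    ext p
    rfl

/-- The final holomorphic map of a homotopy. -/
noncomputable def target : holomorphicPathSet F X ⟶ affineSingularSet F X where
  app n := ↾fun p => ⟨p.final, p.contMDiff_final⟩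
  naturality n m θ := by
    ext p
    rfl

/-- The constant homotopies. -/
noncomputable def const : affineSingularSet F X ⟶ holomorphicPathSet F X where
  app _ := ↾fun g => HolomorphicPath.const g.1 g.2
  naturality _ _ θ := ConcreteCategory.hom_ext _ _ fun g =>
    (HolomorphicPath.const_comp g.1 g.2 θ.unop.toOrderHom).symm

end holomorphicPathSet

end HolomorphicPaths

/-! ### The lifting property of `source` and its section. -/

namespace SSet

/-- A monotone self-map of `[n]` that misses `j` and fixes everything else, as an element of a
subcomplex of `Δ[n]`, if this contains the face opposite to `j`. -/
lemma exists_mem_fix {n : ℕ} (A : (Δ[n] : SSet.{u}).Subcomplex) {j : Fin (n + 1)}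
    (hne : ∃ i, i ≠ j) (hA : stdSimplex.face {j}ᶜ ≤ A) :
    ∃ α : (A : SSet).obj (op ⦋n⦌), ∀ i, i ≠ j → (show Δ[n].obj (op ⦋n⦌) from α.1) i = i := by
  obtain ⟨π, hπ, hπi⟩ := Fin.exists_monotone_retraction ({j}ᶜ : Set (Fin (n + 1))) hne
  refine ⟨⟨stdSimplex.objMk π, hA _ ?_⟩, fun i hi => hπi i hi⟩
  rw [stdSimplex.mem_face_iff]
  intro i
  simpa using hπ i

end SSet

lemma AffineSimplex.map_apply_eq_zero {n m : ℕ} {θ : Fin (n + 1) → Fin (m + 1)} {j : Fin (m + 1)}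
    (hj : j ∉ Set.range θ) (t : AffineSimplex n) : (map θ t).1 j = 0 := by
  rw [map_apply]
  refine Finset.sum_eq_zero fun i hi => ?_
  exact absurd ⟨i, (Finset.mem_filter.1 hi).2⟩ hj

lemma stdSimplex.map_apply_eq_zero {n m : ℕ} {θ : Fin (n + 1) → Fin (m + 1)} {j : Fin (m + 1)}
    (hj : j ∉ Set.range θ) (x : stdSimplex ℝ (Fin (n + 1))) : map θ x j = 0 := by
  rw [map_apply]
  refine Finset.sum_eq_zero fun i hi => ?_
  exact absurd ⟨i, (Finset.mem_filter.1 hi).2⟩ hj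

lemma SSet.map_objEquiv_yonedaEquiv {K : SSet.{u}} {n : SimplexCategory} {m : SimplexCategoryᵒᵖ}
    (c : stdSimplex.obj n ⟶ K) (α : (stdSimplex.obj n).obj m) :
    K.map (stdSimplex.objEquiv α).op (yonedaEquiv c) = c.app m α := by
  have := stdSimplex.map_objEquiv_op_apply (yonedaEquiv c) α
  rwa [Equiv.symm_apply_apply] at this

section Lifting

variable {F : Type v} [NormedAddCommGroup F] [NormedSpace ℂ F]
variable {X : Type u} [TopologicalSpace X] [ChartedSpace F X] [IsManifold 𝓘(ℂ, F) ω X]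

-- The commutativity of a lifting square, evaluated at a point of a simplex.
omit [IsManifold 𝓘(ℂ, F) ω X] in
lemma holomorphicPathSet.path_zero_of_comp_source {n m : SimplexCategory}
    {A : (SSet.stdSimplex.{u}.obj n).Subcomplex}
    (b : (A : SSet) ⟶ holomorphicPathSet F X)
    (c : SSet.stdSimplex.obj n ⟶ TopCat.toSSet.obj (TopCat.of X))
    (w : b ≫ source F X = A.ι ≫ c) (α : (A : SSet).obj (op m)) (x : stdSimplex ℝ (Fin (m.len + 1))) :
    (show HolomorphicPath F X m.len from b.app _ α).path (x, 0) =
      (TopCat.of X).toSSetObjEquiv (op n) (SSet.yonedaEquiv c)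
        (stdSimplex.map (SSet.stdSimplex.objEquiv α.1).toOrderHom x) := by
  have h1 : (b ≫ source F X).app (op m) α = (A.ι ≫ c).app (op m) α := by rw [w]
  rw [NatTrans.comp_app, NatTrans.comp_app, ConcreteCategory.comp_apply,
    ConcreteCategory.comp_apply] at h1
  have h3 : A.ι.app (op m) α = α.1 := rfl
  rw [h3, ← SSet.map_objEquiv_yonedaEquiv c α.1] at h1
  have h2 := congrArg (fun y => (TopCat.of X).toSSetObjEquiv (op m) y x) h1
  exact h2

open SSet in
/-- For an Oka manifold, maps from simplices can be deformed to holomorphic maps relative to the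
boundary. -/
lemma holomorphicPathSet.hasLiftingProperty_boundary (hX : IsOka F X) (n : ℕ) :
    HasLiftingProperty (boundary.{u} n).ι (source F X) where
  sq_hasLift {b c} sq := by
    let P := holomorphicPathSet F X
    let f : C(stdSimplex ℝ (Fin (n + 1)), X) :=
      (TopCat.of X).toSSetObjEquiv (op ⦋n⦌) (yonedaEquiv c)
    have hbf (α : (boundary.{u} n : SSet).obj (op ⦋n⦌)) (x : stdSimplex ℝ (Fin (n + 1))) :
        (show HolomorphicPath F X n from b.app _ α).path (x, 0) =
          f (stdSimplex.map (SSet.stdSimplex.objEquiv α.1).toOrderHom x) :=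
      path_zero_of_comp_source b c sq.w α x
    obtain ⟨g, hg⟩ := exists_glue b (f (stdSimplex.vertex 0)) (W := AffineSimplex n)
      (fun t => {i | t.1 i ≠ 0}) (fun t => t.exists_ne_zero)
      (fun p t => (show HolomorphicPath F X n from p).final t)
      fun κ π t hπ => congrArg (show HolomorphicPath F X n from κ).final
        (AffineSimplex.map_eq_self hπ)
    obtain ⟨H, hH⟩ := exists_glue b (f (stdSimplex.vertex 0))
      (W := stdSimplex ℝ (Fin (n + 1)) × unitInterval)
      (fun w => {i | w.1 i ≠ 0}) (fun w => stdSimplex.exists_ne_zero w.1)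
      (fun p w => (show HolomorphicPath F X n from p).path w)
      fun κ π w hπ => congrArg (fun x => (show HolomorphicPath F X n from κ).path (x, w.2))
        (stdSimplex.map_eq_self hπ)
    -- A representative in degree n of the facet opposite to j. The condition excludes n = 0, where
    -- the boundary is empty.
    have hε (j : Fin (n + 1)) (hj : ∃ i, i ≠ j) :=
      exists_mem_fix (boundary.{u} n) hj (face_singleton_compl_le_boundary j)
    have hne {j : Fin (n + 1)} {t : AffineSimplex n} (ht : t.1 j = 0) : ∃ i, i ≠ j := by
      obtain ⟨i, hi⟩ := t.exists_ne_zero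
      exact ⟨i, fun h => hi (h ▸ ht)⟩
    have hne' {j : Fin (n + 1)} {x : stdSimplex ℝ (Fin (n + 1))} (hx : x j = 0) : ∃ i, i ≠ j := by
      obtain ⟨i, hi⟩ := stdSimplex.exists_ne_zero x
      exact ⟨i, fun h => hi (h ▸ hx)⟩
    have hgε {j : Fin (n + 1)} (hj : ∃ i, i ≠ j) (t : AffineSimplex n) (ht : t.1 j = 0) :
        g t = (show HolomorphicPath F X n from b.app _ (hε j hj).choose).final t :=
      hg _ t fun i hi => (hε j hj).choose_spec i fun h => hi (h ▸ ht)
    have hHε {j : Fin (n + 1)} (hj : ∃ i, i ≠ j) (x : stdSimplex ℝ (Fin (n + 1)))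
        (s : unitInterval) (hx : x j = 0) :
        H (x, s) = (show HolomorphicPath F X n from b.app _ (hε j hj).choose).path (x, s) :=
      hH _ (x, s) fun i hi => (hε j hj).choose_spec i fun h => hi (h ▸ hx)
    obtain ⟨G, K, hG, hGg, hKH, hKf, hKG⟩ := exists_filling hX f g (fun j => by
      by_cases hj : ∃ i, i ≠ j
      · exact ⟨_, HolomorphicPath.contMDiff_final _, hgε hj⟩
      · exact ⟨fun _ => f (stdSimplex.vertex 0), contMDiff_const, fun t ht => absurd (hne ht) hj⟩) H
      (fun j => by
        by_cases hj : ∃ i, i ≠ j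
        · exact (ContinuousMap.continuous _).continuousOn.congr fun p hp => hHε hj p.1 p.2 hp
        · exact fun p hp => absurd (hne' hp) hj)
      (by
        rintro x ⟨j, hj⟩
        rw [hHε (hne' hj) x 0 hj, hbf, stdSimplex.map_eq_self]
        exact fun i hi => (hε j (hne' hj)).choose_spec i fun h => hi (h ▸ hj))
      (by
        -- Each facet comes with its own stationary interval; the shortest of these finitely many
        -- serves the whole boundary.
        have hfin (j : Fin (n + 1)) : ∃ ε : ℝ, 0 < ε ∧ ∀ x : stdSimplex ℝ (Fin (n + 1)), x j = 0 →
            ∀ s : unitInterval, 1 - ε ≤ s → H (x, s) = g (AffineSimplex.ofStdSimplex n x) := by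
          by_cases hj : ∃ i, i ≠ j
          · obtain ⟨ε, hε0, h⟩ :=
              (show HolomorphicPath F X n from b.app _ (hε j hj).choose).stationary
            refine ⟨ε, hε0, fun x hx s hs => ?_⟩
            rw [hHε hj x s hx, hgε hj _ (AffineSimplex.ofStdSimplex_apply_eq_zero.2 hx), h x s hs]
          · exact ⟨1, one_pos, fun x hx => absurd (hne' hx) hj⟩
        choose ε hε0 h using hfin
        obtain ⟨k, -, hk⟩ := Finset.exists_min_image Finset.univ ε Finset.univ_nonempty
        refine ⟨ε k, hε0 k, ?_⟩
        rintro x ⟨j, hj⟩ s hs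
        exact h j x hj s (by linarith [hk j (Finset.mem_univ j)]))
    let ψ : HolomorphicPath F X n := ⟨K, G, hG, hKG⟩
    refine ⟨⟨{ l := yonedaEquiv.symm (show P.obj (op ⦋n⦌) from ψ)
               fac_left := ?_
               fac_right := ?_ }⟩⟩
    · refine NatTrans.ext (funext fun m => ConcreteCategory.hom_ext _ _ fun α => ?_)
      obtain ⟨j, hj⟩ := (mem_boundary_iff_notMem_range (d := m.unop.len) α.1).1 α.2
      have hjne : ∃ i, i ≠ j := ⟨(show Δ[n] _⦋m.unop.len⦌ from α.1) 0, fun h => hj ⟨0, h⟩⟩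
      let a : m.unop ⟶ ⦋n⦌ := SSet.stdSimplex.objEquiv α.1
      -- A simplex of the boundary misses some vertex j, so it is unchanged by composition with the
      -- representative of that facet; this reduces the claim to facets.
      have hα : b.app m α = P.map a.op (b.app _ (hε j hjne).choose) := by
        rw [← NatTrans.naturality_apply]
        congr 1
        apply Subtype.ext
        refine SSet.stdSimplex.ext (d := m.unop.len) _ _ fun i => ?_
        exact ((hε j hjne).choose_spec _ fun h => hj ⟨i, h⟩).symm
      rw [hα]
      refine HolomorphicPath.ext ?_ ?_
      · ext ⟨x, s⟩
        have h0 : stdSimplex.map a.toOrderHom x j = 0 := stdSimplex.map_apply_eq_zero hj x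
        exact (hKH _ ⟨j, h0⟩ s).trans (hHε hjne _ s h0)
      · funext t
        have h0 : (AffineSimplex.map a.toOrderHom t).1 j = 0 :=
          AffineSimplex.map_apply_eq_zero hj t
        exact (hGg _ ⟨j, h0⟩).trans (hgε hjne _ h0)
    · apply SSet.yonedaEquiv.injective
      rw [yonedaEquiv_comp, Equiv.apply_symm_apply]
      apply ((TopCat.of X).toSSetObjEquiv _).injective
      ext x
      exact hKf x

/-- Holomorphic approximation of all singular simplices, compatible with the simplicial structure
and relative to the affine simplices. -/
lemma holomorphicPathSet.exists_section [T2Space X] (hX : IsOka F X) :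
    ∃ s : TopCat.toSSet.obj (TopCat.of X) ⟶ holomorphicPathSet F X,
      s ≫ source F X = 𝟙 _ ∧ affineSingularSetInclusion F X ≫ s = const F X := by
  have : (MorphismProperty.monomorphisms SSet.{u}).rlp (source F X) := by
    rw [SSet.rlp_monomorphisms]
    rintro _ _ _ ⟨n⟩
    exact hasLiftingProperty_boundary hX n
  have := this (affineSingularSetInclusion F X) (mono_affineSingularSetInclusion F X)
  -- A diagonal of this square is a section of `source` that takes affine simplices to constant
  -- homotopies.
  have sq : CommSq (const F X) (affineSingularSetInclusion F X) (source F X) (𝟙 _) := ⟨rfl⟩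
  exact ⟨sq.lift, sq.fac_right, sq.fac_left⟩

end Lifting

/-! ### Singular sets and their retracts are Kan complexes. -/

namespace SSet

open modelCategoryQuillen in
/-- A simplicial set is a Kan complex if all horns have fillers. -/
lemma kanComplex_of_hornFilling {Z : SSet.{u}}
    (h : ∀ (n : ℕ) (i : Fin (n + 2)) (t : (Λ[n + 1, i] : SSet.{u}) ⟶ Z),
      ∃ φ : Δ[n + 1] ⟶ Z, Λ[n + 1, i].ι ≫ φ = t) : KanComplex Z := by
  refine (HomotopicalAlgebra.isFibrant_iff _).2 ⟨?_⟩
  rw [modelCategoryQuillen.fibrations_eq]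
  intro _ _ _ hf
  simp only [modelCategoryQuillen.J, MorphismProperty.iSup_iff] at hf
  obtain ⟨n, ⟨i⟩⟩ := hf
  refine ⟨fun {t _} _ ↦ ?_⟩
  obtain ⟨φ, hφ⟩ := h n i t
  exact ⟨⟨⟨φ, hφ, by subsingleton⟩⟩⟩

end SSet

open SSet in
-- The simplices of the horn are glued to one function on the topological horn, which extends along
-- the retraction of T_{n+1} onto the horn.
lemma TopCat.exists_toSSet_hornFilling (X : TopCat.{u}) (n : ℕ) (i : Fin (n + 2))
    (t : (Λ[n + 1, i] : SSet.{u}) ⟶ TopCat.toSSet.obj X) :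
    ∃ φ : Δ[n + 1] ⟶ TopCat.toSSet.obj X, Λ[n + 1, i].ι ≫ φ = t := by
  have hε (j : Fin (n + 2)) (hj : j ≠ i) :=
    exists_mem_fix (horn.{u} (n + 1) i) (exists_ne j) (face_le_horn j i hj)
  obtain ⟨k, hk⟩ := exists_ne i
  let ev : (TopCat.toSSet.obj X).obj (op ⦋n + 1⦌) → stdSimplex ℝ (Fin (n + 2)) → X :=
    fun κ x => X.toSSetObjEquiv (op ⦋n + 1⦌) κ x
  obtain ⟨G, hG⟩ := exists_glue t (ev (t.app _ (hε k hk).choose) (stdSimplex.vertex 0))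
    (W := stdSimplex ℝ (Fin (n + 2)))
    (fun x => {i | x i ≠ 0}) (fun x => stdSimplex.exists_ne_zero x) ev
    fun κ π x hπ => congrArg (ev κ) (stdSimplex.map_eq_self hπ)
  have hGε {j : Fin (n + 2)} (hj : j ≠ i) (x : stdSimplex ℝ (Fin (n + 2))) (hx : x j = 0) :
      G x = ev (t.app _ (hε j hj).choose) x :=
    hG _ x fun i hi => (hε j hj).choose_spec i fun h => hi (h ▸ hx)
  obtain ⟨g, hg⟩ := stdSimplex.exists_horn_extension i G fun j hj =>
    (X.toSSetObjEquiv (op ⦋n + 1⦌) _).continuous.continuousOn.congr fun x hx => hGε hj x hx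
  refine ⟨SSet.yonedaEquiv.symm ((X.toSSetObjEquiv (op ⦋n + 1⦌)).symm g), ?_⟩
  refine NatTrans.ext (funext fun m => ConcreteCategory.hom_ext _ _ fun α => ?_)
  obtain ⟨j, hji, hj⟩ := (mem_horn_iff_notMem_range (d := m.unop.len) α.1 i).1 α.2
  let a : m.unop ⟶ ⦋n + 1⦌ := SSet.stdSimplex.objEquiv α.1
  have hα : t.app m α = (TopCat.toSSet.obj X).map a.op (t.app _ (hε j hji).choose) := by
    rw [← NatTrans.naturality_apply]
    congr 1
    apply Subtype.ext
    refine SSet.stdSimplex.ext (d := m.unop.len) _ _ fun i => ?_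
    exact ((hε j hji).choose_spec _ fun h => hj ⟨i, h⟩).symm
  rw [hα]
  apply (X.toSSetObjEquiv m).injective
  ext x
  have h0 : stdSimplex.map a.toOrderHom x j = 0 := stdSimplex.map_apply_eq_zero hj x
  exact (hg j hji _ h0).trans (hGε hji _ h0)

namespace SSet

/-- A retract of a singular simplicial set is a Kan complex. -/
lemma kanComplex_of_retract {Z : SSet.{u}} {X : TopCat.{u}} (i : Z ⟶ TopCat.toSSet.obj X)
    (r : TopCat.toSSet.obj X ⟶ Z) (h : i ≫ r = 𝟙 Z) : KanComplex Z := by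
  refine kanComplex_of_hornFilling fun n k t => ?_
  obtain ⟨φ, hφ⟩ := X.exists_toSSet_hornFilling n k (t ≫ i)
  exact ⟨φ ≫ r, by rw [← Category.assoc, hφ, Category.assoc, h, Category.comp_id]⟩

end SSet

/-! ### The simplicial deformation retraction. -/

/-- The parameter in `[0, 1]` of the point of the prism over `x` given by a monotone map
to `{0, 1}`. -/
noncomputable def stdSimplex.parameter {n : ℕ} (τ : Fin (n + 1) → Fin 2)
    (x : stdSimplex ℝ (Fin (n + 1))) : unitInterval :=
  ⟨map τ x 1, (map τ x).2.1 1, le_one _ 1⟩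

namespace stdSimplex

lemma continuous_parameter {n : ℕ} (τ : Fin (n + 1) → Fin 2) : Continuous (parameter τ) :=
  Continuous.subtype_mk ((continuous_apply (n := 1) 1).comp (continuous_map τ)) _

lemma parameter_map {n m : ℕ} (τ : Fin (m + 1) → Fin 2) (θ : Fin (n + 1) → Fin (m + 1))
    (x : stdSimplex ℝ (Fin (n + 1))) : parameter τ (map θ x) = parameter (τ ∘ θ) x := by
  apply Subtype.ext
  change map τ (map θ x) 1 = map (τ ∘ θ) x 1
  rw [map_comp_apply]

lemma parameter_zero {n : ℕ} (x : stdSimplex ℝ (Fin (n + 1))) :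
    parameter (fun _ => 0) x = 0 := by
  apply Subtype.ext
  change map (fun _ => 0) x 1 = 0
  simp [map_apply]

lemma parameter_one {n : ℕ} (x : stdSimplex ℝ (Fin (n + 1))) :
    parameter (fun _ => 1) x = 1 := by
  apply Subtype.ext
  change map (fun _ => 1) x 1 = 1
  simp [map_apply]

end stdSimplex

section DeformationRetract

variable {F : Type v} [NormedAddCommGroup F] [NormedSpace ℂ F]
variable {X : Type u} [TopologicalSpace X] [ChartedSpace F X]

lemma HolomorphicPath.path_one {n : ℕ} (p : HolomorphicPath F X n)
    (x : stdSimplex ℝ (Fin (n + 1))) : p.path (x, 1) = p.final (AffineSimplex.ofStdSimplex n x) := by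
  obtain ⟨ε, hε, h⟩ := p.stationary
  exact h x 1 (by simp [hε.le])

/-- The singular simplex obtained from a homotopy and a map to the interval. -/
noncomputable def HolomorphicPath.restrict {n : ℕ} (p : HolomorphicPath F X n)
    (τ : Fin (n + 1) → Fin 2) : C(stdSimplex ℝ (Fin (n + 1)), X) where
  toFun x := p.path (x, stdSimplex.parameter τ x)
  continuous_toFun := p.path.continuous.comp
    (continuous_id.prodMk (stdSimplex.continuous_parameter τ))

lemma HolomorphicPath.comp_restrict {n m : ℕ} (p : HolomorphicPath F X m)
    (θ : Fin (n + 1) → Fin (m + 1)) (τ : Fin (m + 1) → Fin 2) :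
    (p.comp θ).restrict (τ ∘ θ) =
      (p.restrict τ).comp ⟨stdSimplex.map θ, stdSimplex.continuous_map θ⟩ := by
  ext x
  exact congrArg (fun u => p.path (stdSimplex.map θ x, u)) (stdSimplex.parameter_map τ θ x).symm

/-- The simplicial homotopy on the singular set defined by a section of the simplicial set of
homotopies with holomorphic final maps. -/
noncomputable def holomorphicPathSet.homotopy
    (s : TopCat.toSSet.obj (TopCat.of X) ⟶ holomorphicPathSet F X) :
    TopCat.toSSet.obj (TopCat.of X) ⊗ Δ[1] ⟶ TopCat.toSSet.obj (TopCat.of X) where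
  app n := ↾fun p => ((TopCat.of X).toSSetObjEquiv n).symm
    ((show HolomorphicPath F X n.unop.len from s.app n p.1).restrict
      (SSet.stdSimplex.objEquiv p.2).toOrderHom)
  naturality n m θ := by
    refine ConcreteCategory.hom_ext _ _ fun p => ?_
    have h1 : s.app m ((TopCat.toSSet.obj (TopCat.of X)).map θ p.1) =
        (holomorphicPathSet F X).map θ (s.app n p.1) := NatTrans.naturality_apply s θ p.1
    change ((TopCat.of X).toSSetObjEquiv m).symm ((show HolomorphicPath F X m.unop.len from
      s.app m ((TopCat.toSSet.obj (TopCat.of X)).map θ p.1)).restrict _) = _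
    rw [h1]
    exact congrArg ((TopCat.of X).toSSetObjEquiv m).symm (HolomorphicPath.comp_restrict
      (s.app n p.1) θ.unop.toOrderHom (SSet.stdSimplex.objEquiv p.2).toOrderHom)

/-- The homotopy starts at the identity because s is a section of `source`, and it is constant on eX
because s gives constant homotopies there. -/
lemma isStrongDeformationRetract_of_section
    (s : TopCat.toSSet.obj (TopCat.of X) ⟶ holomorphicPathSet F X)
    (hs : s ≫ holomorphicPathSet.source F X = 𝟙 _)
    (hi : affineSingularSetInclusion F X ≫ s = holomorphicPathSet.const F X) :
    SSet.IsStrongDeformationRetract (affineSingularSetInclusion F X) := by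
  refine ⟨s ≫ holomorphicPathSet.target F X, ?_, holomorphicPathSet.homotopy s, ?_, ?_, ?_⟩
  · rw [← Category.assoc, hi]
    rfl
  · refine NatTrans.ext (funext fun n => ConcreteCategory.hom_ext _ _ fun σ => ?_)
    have h1 : (s ≫ holomorphicPathSet.source F X).app n σ = σ := by rw [hs]; rfl
    refine Eq.trans ?_ h1
    apply ((TopCat.of X).toSSetObjEquiv n).injective
    ext x
    exact congrArg (fun u => (show HolomorphicPath F X n.unop.len from s.app n σ).path (x, u))
      (stdSimplex.parameter_zero x)
  · refine NatTrans.ext (funext fun n => ConcreteCategory.hom_ext _ _ fun σ => ?_)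
    apply ((TopCat.of X).toSSetObjEquiv n).injective
    ext x
    exact (congrArg (fun u => (show HolomorphicPath F X n.unop.len from s.app n σ).path (x, u))
      (stdSimplex.parameter_one x)).trans (HolomorphicPath.path_one _ x)
  · refine NatTrans.ext (funext fun n => ConcreteCategory.hom_ext _ _ fun p => ?_)
    have h1 : s.app n ((affineSingularSetInclusion F X).app n p.1) =
        (holomorphicPathSet.const F X).app n p.1 := by rw [← hi]; rfl
    apply ((TopCat.of X).toSSetObjEquiv n).injective
    ext x
    change (show HolomorphicPath F X n.unop.len from
      s.app n ((affineSingularSetInclusion F X).app n p.1)).path (x, _) = _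
    rw [h1]
    rfl

end DeformationRetract

/-! ### A criterion for weak homotopy equivalences. -/

section WeakEquivalence

variable {A B : Type*} [TopologicalSpace A] [TopologicalSpace B]

/-- The expansion of the interval with fixed endpoints by the factor `1 + 2τ`. -/
noncomputable def unitInterval.expand (τ y : unitInterval) : unitInterval :=
  Set.projIcc 0 1 zero_le_one ((1 + 2 * τ) * y - τ : ℝ)

namespace unitInterval

lemma continuous_expand : Continuous fun p : unitInterval × unitInterval => expand p.1 p.2 :=
  continuous_projIcc.comp (by fun_prop)

lemma expand_zero_left (y : unitInterval) : expand 0 y = y := by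
  simp [expand]

lemma expand_zero_right (τ : unitInterval) : expand τ 0 = 0 :=
  Set.projIcc_of_le_left _ (by simpa using τ.2.1)

lemma expand_one_right (τ : unitInterval) : expand τ 1 = 1 :=
  Set.projIcc_of_right_le _ (by
    have := τ.2.1
    simp only [Set.Icc.coe_one, mul_one]
    linarith)

/-- A cut-off function vanishing at the endpoints and equal to `1` in the middle third. -/
noncomputable def bump (y : unitInterval) : unitInterval :=
  Set.projIcc 0 1 zero_le_one (3 * y : ℝ) * Set.projIcc 0 1 zero_le_one (3 * (1 - y) : ℝ)

lemma continuous_bump : Continuous bump :=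
  (continuous_projIcc.comp (by fun_prop)).mul (continuous_projIcc.comp (by fun_prop))

lemma bump_zero : bump 0 = 0 := by
  rw [bump, Set.projIcc_of_le_left _ (by simp)]
  exact zero_mul _

lemma bump_one : bump 1 = 0 := by
  rw [bump, Set.projIcc_of_le_left zero_le_one (x := 3 * (1 - ((1 : unitInterval) : ℝ))) (by simp)]
  exact mul_zero _

/-- `expand 1` collapses the outer thirds to the endpoints, so y lies in the middle third. -/
lemma bump_eq_one {y : unitInterval} (h0 : expand 1 y ≠ 0) (h1 : expand 1 y ≠ 1) :
    bump y = 1 := by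
  have h0' : 1 ≤ 3 * (y : ℝ) := by
    by_contra! h
    refine h0 (Set.projIcc_of_le_left _ ?_)
    simp only [Set.Icc.coe_one]
    linarith
  have h1' : 1 ≤ 3 * (1 - (y : ℝ)) := by
    by_contra! h
    refine h1 (Set.projIcc_of_right_le _ ?_)
    simp only [Set.Icc.coe_one]
    linarith
  rw [bump, Set.projIcc_of_right_le _ h0', Set.projIcc_of_right_le _ h1']
  exact mul_one _

end unitInterval

open unitInterval in
/-- Let `r` be a retraction of `i : A → B` and let `Φ` be a homotopy from the identity of `B` to
`i ∘ r` that preserves the range of `i`. Then `i` is a weak homotopy equivalence. -/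
theorem ContinuousMap.isWeakHomotopyEquiv_of_retraction (i : C(A, B)) (r : C(B, A))
    (hri : ∀ a, r (i a) = a) (Φ : C(B, C(unitInterval, B))) (hΦ₀ : ∀ b, Φ b 0 = b)
    (hΦ₁ : ∀ b, Φ b 1 = i (r b)) (hΦi : ∀ a s, Φ (i a) s ∈ Set.range i) :
    i.IsWeakHomotopyEquiv := by
  have hΦ : Continuous fun p : B × unitInterval => Φ p.1 p.2 :=
    ContinuousMap.continuous_uncurry_of_continuous Φ
  refine ⟨⟨?_, ?_⟩, fun n a => ⟨?_, ?_⟩⟩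
  · rintro ⟨a⟩ ⟨a'⟩ h
    have h1 : Joined (i a) (i a') := Quotient.exact h
    have h2 := h1.map r.continuous
    rw [hri, hri] at h2
    exact Quotient.sound h2
  · rintro ⟨b⟩
    refine ⟨Quotient.mk _ (r b), Quotient.sound ?_⟩
    exact Joined.symm ⟨⟨Φ b, hΦ₀ b, hΦ₁ b⟩⟩
  · rintro ⟨p⟩ ⟨q⟩ h
    obtain ⟨H⟩ : (i.comp p.1).HomotopicRel (i.comp q.1) (Cube.boundary (Fin (n + 1))) :=
      Quotient.exact h
    refine Quotient.sound ⟨⟨⟨⟨fun y => r (H y), by fun_prop⟩, fun y => ?_, fun y => ?_⟩, ?_⟩⟩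
    · exact (congrArg r (H.apply_zero y)).trans (hri _)
    · exact (congrArg r (H.apply_one y)).trans (hri _)
    · exact fun s y hy => (congrArg r (H.eq_fst s hy)).trans (hri _)
  · rintro ⟨q⟩
    -- Φ may move the base point i a. To keep it fixed, q is squeezed into the middle cube, and the
    -- time in Φ is multiplied by u, which vanishes on the boundary of the outer cube. In the collar
    -- between, q is i a.
    let st : unitInterval × (Fin (n + 1) → unitInterval) → (Fin (n + 1) → unitInterval) :=
      fun p j => expand p.1 (p.2 j)
    have hst : Continuous st := continuous_pi fun j =>
      continuous_expand.comp (continuous_fst.prodMk ((continuous_apply j).comp continuous_snd))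
    have hst0 (y) : st (0, y) = y := funext fun j => expand_zero_left _
    have hst_mem (τ y) (hy : y ∈ Cube.boundary (Fin (n + 1))) :
        st (τ, y) ∈ Cube.boundary (Fin (n + 1)) := by
      obtain ⟨j, hj | hj⟩ := hy
      · exact ⟨j, Or.inl (by simp only [st, hj]; exact expand_zero_right τ)⟩
      · exact ⟨j, Or.inr (by simp only [st, hj]; exact expand_one_right τ)⟩
    let u : (Fin (n + 1) → unitInterval) → unitInterval := fun y => ∏ j, bump (y j)
    have hu : Continuous u :=
      continuous_finsetProd _ fun j _ => continuous_bump.comp (continuous_apply j)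
    have hu0 (y) (hy : y ∈ Cube.boundary (Fin (n + 1))) : u y = 0 := by
      obtain ⟨j, hj⟩ := hy
      refine Finset.prod_eq_zero (Finset.mem_univ j) ?_
      rcases hj with hj | hj <;> rw [hj]
      · exact bump_zero
      · exact bump_one
    have hu1 (y) (hy : st (1, y) ∉ Cube.boundary (Fin (n + 1))) : u y = 1 := by
      refine Finset.prod_eq_one fun j _ => bump_eq_one (fun h => hy ⟨j, Or.inl h⟩)
        fun h => hy ⟨j, Or.inr h⟩
    let W : C(unitInterval × (Fin (n + 1) → unitInterval), B) :=
      ⟨fun p => Φ (q.1 (st p)) (p.1 * u p.2), hΦ.comp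
        ((q.1.continuous.comp hst).prodMk (continuous_fst.mul (hu.comp continuous_snd)))⟩
    have hW (τ y) (hy : y ∈ Cube.boundary (Fin (n + 1))) : W (τ, y) = i a := by
      change Φ (q.1 (st (τ, y))) (τ * u y) = i a
      rw [q.2 _ (hst_mem τ y hy), hu0 y hy, mul_zero, hΦ₀]
    have hWr (y) : i (r (W (1, y))) = W (1, y) := by
      -- In the collar, Φ moves i a inside the range of i; in the middle cube u = 1 and Φ has
      -- arrived at i ∘ r.
      have : W (1, y) ∈ Set.range i := by
        change Φ (q.1 (st (1, y))) (1 * u y) ∈ Set.range i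
        by_cases hy : st (1, y) ∈ Cube.boundary (Fin (n + 1))
        · rw [q.2 _ hy]
          exact hΦi _ _
        · rw [hu1 y hy, one_mul, hΦ₁]
          exact ⟨_, rfl⟩
      obtain ⟨a', ha'⟩ := this
      rw [← ha', hri]
    let p : GenLoop (Fin (n + 1)) A a := ⟨⟨fun y => r (W (1, y)), by fun_prop⟩, fun y hy => by
      change r (W (1, y)) = a
      rw [hW 1 y hy, hri]⟩
    refine ⟨Quotient.mk _ p, Quotient.sound (GenLoop.Homotopic.symm ?_)⟩
    refine ⟨⟨⟨W, fun y => ?_, fun y => ?_⟩, fun τ y hy => ?_⟩⟩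
    · change Φ (q.1 (st (0, y))) (0 * u y) = q.1 y
      rw [hst0, zero_mul, hΦ₀]
    · exact (hWr y).symm
    · exact (hW τ y hy).trans (q.2 y hy).symm

end WeakEquivalence

/-! ### The join of [n] with itself. -/

namespace SimplexCategory

/-- The join of `[n]` with itself. -/
abbrev double (n : SimplexCategory) : SimplexCategory := ⦋n.len + 1 + n.len⦌

variable {n m : SimplexCategory}

/-- The first copy of `[n]` in its join with itself. -/
def doubleInl (n : SimplexCategory) : n ⟶ n.double :=
  SimplexCategory.Hom.mk ⟨Fin.castAdd (n.len + 1), fun _ _ h => h⟩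

/-- The second copy of `[n]` in its join with itself. -/
def doubleInr (n : SimplexCategory) : n ⟶ n.double :=
  SimplexCategory.Hom.mk ⟨Fin.natAdd (n.len + 1), fun _ _ h => Nat.add_le_add_left h _⟩

/-- The map from the join of `[n]` with itself to `[n]`, which is not monotone. -/
def doubleFold (n : SimplexCategory) : Fin (n.double.len + 1) → Fin (n.len + 1) :=
  Fin.addCases (m := n.len + 1) (n := n.len + 1) id id

/-- The map from the join of `[n]` with itself to `[1]`. -/
def doubleSide (n : SimplexCategory) : Fin (n.double.len + 1) → Fin 2 :=
  Fin.addCases (m := n.len + 1) (n := n.len + 1) (fun _ => 0) fun _ => 1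

/-- The join of a monotone map with itself. -/
def doubleMap (θ : n ⟶ m) : n.double ⟶ m.double :=
  SimplexCategory.Hom.mk ⟨Fin.addCases (m := n.len + 1) (n := n.len + 1)
    (fun i => (Fin.castAdd (m.len + 1) (θ.toOrderHom i) : Fin (m.len + 1 + (m.len + 1))))
    fun i => Fin.natAdd (m.len + 1) (θ.toOrderHom i), by
      intro i j
      refine Fin.addCases (m := n.len + 1) (n := n.len + 1) (fun i => ?_) (fun i => ?_) i <;>
      refine Fin.addCases (m := n.len + 1) (n := n.len + 1) (fun j => ?_) (fun j => ?_) j <;>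
      intro h
      · simp only [Fin.addCases_left]
        exact θ.toOrderHom.monotone (show i ≤ j from h)
      · simp only [Fin.addCases_left, Fin.addCases_right]
        rw [Fin.le_def]
        simp only [Fin.val_castAdd, Fin.val_natAdd]
        have := (θ.toOrderHom i).2
        omega
      · exfalso
        rw [Fin.le_def] at h
        simp only [Fin.val_castAdd, Fin.val_natAdd] at h
        have := j.2
        omega
      · simp only [Fin.addCases_right]
        have h1 : i ≤ j := by
          rw [Fin.le_def] at h ⊢
          simp only [Fin.val_natAdd] at h
          omega
        have h2 := θ.toOrderHom.monotone h1
        rw [Fin.le_def] at h2 ⊢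
        simp only [Fin.val_natAdd]
        omega⟩

lemma doubleFold_comp_inl : doubleFold n ∘ (doubleInl n).toOrderHom = id :=
  funext fun i => Fin.addCases_left (m := n.len + 1) (n := n.len + 1)
    (motive := fun _ => Fin (n.len + 1)) (left := id) (right := id) i

lemma doubleFold_comp_inr : doubleFold n ∘ (doubleInr n).toOrderHom = id :=
  funext fun i => Fin.addCases_right (m := n.len + 1) (n := n.len + 1)
    (motive := fun _ => Fin (n.len + 1)) (left := id) (right := id) i

lemma doubleSide_comp_inl : doubleSide n ∘ (doubleInl n).toOrderHom = fun _ => 0 :=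
  funext fun i => Fin.addCases_left (m := n.len + 1) (n := n.len + 1)
    (motive := fun _ => Fin 2) (left := fun _ => 0) (right := fun _ => 1) i

lemma doubleSide_comp_inr : doubleSide n ∘ (doubleInr n).toOrderHom = fun _ => 1 :=
  funext fun i => Fin.addCases_right (m := n.len + 1) (n := n.len + 1)
    (motive := fun _ => Fin 2) (left := fun _ => 0) (right := fun _ => 1) i

lemma doubleMap_comp_inl (θ : n ⟶ m) : doubleInl n ≫ doubleMap θ = θ ≫ doubleInl m := by
  ext i : 3
  exact Fin.addCases_left (m := n.len + 1) (n := n.len + 1)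
    (motive := fun _ => Fin (m.len + 1 + (m.len + 1)))
    (left := fun i => Fin.castAdd (m.len + 1) (θ.toOrderHom i))
    (right := fun i => Fin.natAdd (m.len + 1) (θ.toOrderHom i)) i

lemma doubleMap_comp_inr (θ : n ⟶ m) : doubleInr n ≫ doubleMap θ = θ ≫ doubleInr m := by
  ext i : 3
  exact Fin.addCases_right (m := n.len + 1) (n := n.len + 1)
    (motive := fun _ => Fin (m.len + 1 + (m.len + 1)))
    (left := fun i => Fin.castAdd (m.len + 1) (θ.toOrderHom i))
    (right := fun i => Fin.natAdd (m.len + 1) (θ.toOrderHom i)) i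

lemma doubleFold_comp_map (θ : n ⟶ m) :
    doubleFold m ∘ (doubleMap θ).toOrderHom = θ.toOrderHom ∘ doubleFold n := by
  funext i
  refine Fin.addCases (m := n.len + 1) (n := n.len + 1) (fun i => ?_) (fun i => ?_) i
  · have h1 := congrArg (fun f => doubleFold m (f.toOrderHom i)) (doubleMap_comp_inl θ)
    have h2 := congrFun (doubleFold_comp_inl (n := m)) (θ.toOrderHom i)
    have h3 := congrArg θ.toOrderHom (congrFun (doubleFold_comp_inl (n := n)) i)
    exact (h1.trans h2).trans h3.symm
  · have h1 := congrArg (fun f => doubleFold m (f.toOrderHom i)) (doubleMap_comp_inr θ)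
    have h2 := congrFun (doubleFold_comp_inr (n := m)) (θ.toOrderHom i)
    have h3 := congrArg θ.toOrderHom (congrFun (doubleFold_comp_inr (n := n)) i)
    exact (h1.trans h2).trans h3.symm

lemma doubleSide_comp_map (θ : n ⟶ m) :
    doubleSide m ∘ (doubleMap θ).toOrderHom = doubleSide n := by
  funext i
  refine Fin.addCases (m := n.len + 1) (n := n.len + 1) (fun i => ?_) (fun i => ?_) i
  · have h1 := congrArg (fun f => doubleSide m (f.toOrderHom i)) (doubleMap_comp_inl θ)
    have h2 := congrFun (doubleSide_comp_inl (n := m)) (θ.toOrderHom i)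
    exact (h1.trans h2).trans (congrFun (doubleSide_comp_inl (n := n)) i).symm
  · have h1 := congrArg (fun f => doubleSide m (f.toOrderHom i)) (doubleMap_comp_inr θ)
    have h2 := congrFun (doubleSide_comp_inr (n := m)) (θ.toOrderHom i)
    exact (h1.trans h2).trans (congrFun (doubleSide_comp_inr (n := n)) i).symm

end SimplexCategory

/-! ### Homotopies of geometric realizations from doublings. -/

namespace SSet

/-- The map from the standard simplex to the geometric realization defined by a simplex. -/
noncomputable def realize (K : SSet.{u}) {n : SimplexCategory} (κ : K.obj (op n)) :
    C(_root_.stdSimplex ℝ (Fin (n.len + 1)), SSet.toTop.obj K) :=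
  TopCat.toSSetObjEquiv _ (op n) ((sSetTopAdj.unit.app K).app (op n) κ)

lemma realize_map {K : SSet.{u}} {n m : SimplexCategory} (θ : n ⟶ m) (κ : K.obj (op m))
    (x : _root_.stdSimplex ℝ (Fin (n.len + 1))) :
    K.realize (K.map θ.op κ) x = K.realize κ (_root_.stdSimplex.map θ.toOrderHom x) := by
  have h := NatTrans.naturality_apply (sSetTopAdj.unit.app K) θ.op κ
  exact congrArg (fun y => TopCat.toSSetObjEquiv _ (op n) y x) h

lemma toTop_map_realize {K L : SSet.{u}} (φ : K ⟶ L) {n : SimplexCategory} (κ : K.obj (op n))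
    (x : _root_.stdSimplex ℝ (Fin (n.len + 1))) :
    SSet.toTop.map φ (K.realize κ x) = L.realize (φ.app (op n) κ) x := by
  have h := NatTrans.congr_app (sSetTopAdj.unit.naturality φ) (op n)
  have h1 := ConcreteCategory.congr_hom h κ
  exact (congrArg (fun y => TopCat.toSSetObjEquiv _ (op n) y x) h1).symm

lemma homEquiv_realize {K : SSet.{u}} {Y : TopCat.{u}} (f : SSet.toTop.obj K ⟶ Y)
    {n : SimplexCategory} (κ : K.obj (op n)) (x : _root_.stdSimplex ℝ (Fin (n.len + 1))) :
    f (K.realize κ x) = TopCat.toSSetObjEquiv Y (op n)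
      ((sSetTopAdj.homEquiv K Y f).app (op n) κ) x := by
  rw [Adjunction.homEquiv_unit]
  rfl

lemma toTop_hom_ext {K : SSet.{u}} {Y : TopCat.{u}} {f g : SSet.toTop.obj K ⟶ Y}
    (h : ∀ (n : SimplexCategory) (κ : K.obj (op n)) (x : _root_.stdSimplex ℝ (Fin (n.len + 1))),
      f (K.realize κ x) = g (K.realize κ x)) : f = g := by
  apply (sSetTopAdj.homEquiv K Y).injective
  refine NatTrans.ext (funext fun n => ConcreteCategory.hom_ext _ _ fun κ => ?_)
  apply (Y.toSSetObjEquiv n).injective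
  ext x
  rw [← homEquiv_realize f (n := n.unop) κ x, ← homEquiv_realize g (n := n.unop) κ x, h]

end SSet

namespace SSet

open SimplexCategory

/-- A family of maps from the `n`-simplices of `K` to the `(2n + 1)`-simplices of `L` that is natural
with respect to the joins of monotone maps with themselves. -/
structure Doubling (K L : SSet.{u}) where
  /-- The map from `n`-simplices to `(2n + 1)`-simplices. -/
  app (n : SimplexCategory) : K.obj (op n) → L.obj (op n.double)
  naturality {n m : SimplexCategory} (θ : n ⟶ m) (κ : K.obj (op m)) :
    app n (K.map θ.op κ) = L.map (doubleMap θ).op (app m κ)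

namespace Doubling

variable {K L : SSet.{u}} (D : Doubling K L)

/-- The path-valued map on the standard simplex defined by the double of a simplex. -/
noncomputable def path {n : SimplexCategory} (κ : K.obj (op n)) :
    C(_root_.stdSimplex ℝ (Fin (n.len + 1)), C(unitInterval, SSet.toTop.obj L)) :=
  ContinuousMap.curry ⟨fun p => L.realize (D.app n κ) (_root_.stdSimplex.segment
      (_root_.stdSimplex.map (doubleInl n).toOrderHom p.1)
      (_root_.stdSimplex.map (doubleInr n).toOrderHom p.1) p.2),
    (L.realize (D.app n κ)).continuous.comp (_root_.stdSimplex.continuous_segment.comp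
      ((((_root_.stdSimplex.continuous_map _).comp continuous_fst).prodMk
        ((_root_.stdSimplex.continuous_map _).comp continuous_fst)).prodMk continuous_snd))⟩

lemma path_apply {n : SimplexCategory} (κ : K.obj (op n))
    (x : _root_.stdSimplex ℝ (Fin (n.len + 1))) (s : unitInterval) :
    D.path κ x s = L.realize (D.app n κ) (_root_.stdSimplex.segment
      (_root_.stdSimplex.map (doubleInl n).toOrderHom x)
      (_root_.stdSimplex.map (doubleInr n).toOrderHom x) s) := rfl

/-- The compatibility needed to glue the paths over all simplices: `doubleMap θ` respects both
copies of the simplex, and affine maps respect segments. -/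
lemma path_map {n m : SimplexCategory} (θ : n ⟶ m) (κ : K.obj (op m))
    (x : _root_.stdSimplex ℝ (Fin (n.len + 1))) :
    D.path (K.map θ.op κ) x = D.path κ (_root_.stdSimplex.map θ.toOrderHom x) := by
  ext s
  rw [path_apply, path_apply, D.naturality, realize_map, _root_.stdSimplex.map_segment,
    _root_.stdSimplex.map_comp_apply, _root_.stdSimplex.map_comp_apply,
    _root_.stdSimplex.map_comp_apply, _root_.stdSimplex.map_comp_apply]
  have h1 := congrArg (fun f : n ⟶ m.double => ⇑f.toOrderHom) (doubleMap_comp_inl θ)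
  have h2 := congrArg (fun f : n ⟶ m.double => ⇑f.toOrderHom) (doubleMap_comp_inr θ)
  exact congrArg₂ (fun f g => L.realize (D.app m κ) (_root_.stdSimplex.segment
    (_root_.stdSimplex.map f x) (_root_.stdSimplex.map g x) s)) h1 h2

/-- The homotopy of maps between geometric realizations defined by a doubling. -/
noncomputable def homotopy :
    SSet.toTop.obj K ⟶ TopCat.of C(unitInterval, SSet.toTop.obj L) :=
  -- With values in the path space, the homotopy is a single map out of |K|, so it corresponds to a
  -- simplicial map from K to the singular set of the path space.
  (sSetTopAdj.homEquiv _ _).symm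
    { app n := ↾fun κ => (TopCat.toSSetObjEquiv _ n).symm (D.path (n := n.unop) κ)
      naturality n m θ := by
        refine ConcreteCategory.hom_ext _ _ fun κ => ?_
        apply (TopCat.toSSetObjEquiv _ m).injective
        ext x : 1
        exact D.path_map θ.unop κ x }

lemma homotopy_realize {n : SimplexCategory} (κ : K.obj (op n))
    (x : _root_.stdSimplex ℝ (Fin (n.len + 1))) : D.homotopy (K.realize κ x) = D.path κ x := by
  rw [homEquiv_realize, homotopy, Equiv.apply_symm_apply]
  rfl

lemma homotopy_zero (φ : K ⟶ L)
    (h : ∀ (n : SimplexCategory) (κ : K.obj (op n)),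
      L.map (doubleInl n).op (D.app n κ) = φ.app _ κ)
    (z : SSet.toTop.obj K) :
    (show C(unitInterval, SSet.toTop.obj L) from D.homotopy z) 0 = SSet.toTop.map φ z := by
  let e : TopCat.of C(unitInterval, SSet.toTop.obj L) ⟶ SSet.toTop.obj L :=
    TopCat.ofHom ⟨fun γ => γ 0, continuous_eval_const 0⟩
  have : D.homotopy ≫ e = SSet.toTop.map φ := by
    refine toTop_hom_ext fun n κ x => ?_
    change (show C(unitInterval, SSet.toTop.obj L) from D.homotopy (K.realize κ x)) 0 = _
    rw [homotopy_realize, toTop_map_realize, ← h, realize_map]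
    exact congrArg (L.realize (D.app n κ)) (_root_.stdSimplex.segment_zero _ _)
  exact ConcreteCategory.congr_hom this z

lemma homotopy_one (φ : K ⟶ L)
    (h : ∀ (n : SimplexCategory) (κ : K.obj (op n)),
      L.map (doubleInr n).op (D.app n κ) = φ.app _ κ)
    (z : SSet.toTop.obj K) :
    (show C(unitInterval, SSet.toTop.obj L) from D.homotopy z) 1 = SSet.toTop.map φ z := by
  let e : TopCat.of C(unitInterval, SSet.toTop.obj L) ⟶ SSet.toTop.obj L :=
    TopCat.ofHom ⟨fun γ => γ 1, continuous_eval_const 1⟩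
  have : D.homotopy ≫ e = SSet.toTop.map φ := by
    refine toTop_hom_ext fun n κ x => ?_
    change (show C(unitInterval, SSet.toTop.obj L) from D.homotopy (K.realize κ x)) 1 = _
    rw [homotopy_realize, toTop_map_realize, ← h, realize_map]
    exact congrArg (L.realize (D.app n κ)) (_root_.stdSimplex.segment_one _ _)
  exact ConcreteCategory.congr_hom this z

/-- The homotopies of compatible doublings are compatible. -/
lemma homotopy_comp {i : K ⟶ L} (D : Doubling L L) (D' : Doubling K K)
    (h : ∀ (n : SimplexCategory) (κ : K.obj (op n)),
      D.app n (i.app _ κ) = i.app _ (D'.app n κ)) (z : SSet.toTop.obj K) (s : unitInterval) :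
    (show C(unitInterval, SSet.toTop.obj L) from D.homotopy (SSet.toTop.map i z)) s =
      SSet.toTop.map i ((show C(unitInterval, SSet.toTop.obj K) from D'.homotopy z) s) := by
  let e : TopCat.of C(unitInterval, SSet.toTop.obj L) ⟶ SSet.toTop.obj L :=
    TopCat.ofHom ⟨fun γ => γ s, continuous_eval_const s⟩
  let e' : TopCat.of C(unitInterval, SSet.toTop.obj K) ⟶ SSet.toTop.obj K :=
    TopCat.ofHom ⟨fun γ => γ s, continuous_eval_const s⟩
  have : SSet.toTop.map i ≫ D.homotopy ≫ e = D'.homotopy ≫ e' ≫ SSet.toTop.map i := by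
    refine toTop_hom_ext fun n κ x => ?_
    change (show C(unitInterval, SSet.toTop.obj L) from
      D.homotopy (SSet.toTop.map i (K.realize κ x))) s = SSet.toTop.map i
        ((show C(unitInterval, SSet.toTop.obj K) from D'.homotopy (K.realize κ x)) s)
    rw [toTop_map_realize, homotopy_realize, homotopy_realize]
    refine Eq.trans ?_ (toTop_map_realize i (D'.app n κ) _).symm
    rw [← h]
    rfl
  exact ConcreteCategory.congr_hom this z

end Doubling

/-- A monomorphism with a retraction, together with a doubling that connects the identity with the
retraction and preserves the source, is a weak equivalence. -/
lemma isWeakEquivalence_of_doubling {K L : SSet.{u}} (i : K ⟶ L) (r : L ⟶ K) (hir : i ≫ r = 𝟙 K)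
    (D : Doubling L L) (D' : Doubling K K)
    (hD₀ : ∀ (n : SimplexCategory) (κ : L.obj (op n)), L.map (doubleInl n).op (D.app n κ) = κ)
    (hD₁ : ∀ (n : SimplexCategory) (κ : L.obj (op n)),
      L.map (doubleInr n).op (D.app n κ) = i.app _ (r.app _ κ))
    (hDi : ∀ (n : SimplexCategory) (κ : K.obj (op n)),
      D.app n (i.app _ κ) = i.app _ (D'.app n κ)) :
    IsWeakEquivalence i := by
  refine ContinuousMap.isWeakHomotopyEquiv_of_retraction (SSet.toTop.map i).hom
    (SSet.toTop.map r).hom (fun a => ?_) D.homotopy.hom (fun b => ?_) (fun b => ?_) fun a s => ?_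
  · have h : SSet.toTop.map i ≫ SSet.toTop.map r = 𝟙 _ := by
      rw [← CategoryTheory.Functor.map_comp, hir, CategoryTheory.Functor.map_id]
    exact ConcreteCategory.congr_hom h a
  · refine (D.homotopy_zero (𝟙 L) hD₀ b).trans ?_
    rw [CategoryTheory.Functor.map_id]
    rfl
  · refine (D.homotopy_one (r ≫ i) hD₁ b).trans ?_
    rw [CategoryTheory.Functor.map_comp]
    rfl
  -- On |K| the homotopy comes from `D'`; it stays in |K| but need not be constant.
  · exact ⟨_, (Doubling.homotopy_comp D D' hDi a s).symm⟩

end SSet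

/-! ### The doublings of sX and eX, and the conclusion. -/

section Conclusion

open SimplexCategory

variable {F : Type v} [NormedAddCommGroup F] [NormedSpace ℂ F]
variable {X : Type u} [TopologicalSpace X] [ChartedSpace F X]

/-- The `(2n + 1)`-simplex `T_{2n + 1} → T_n × I → X` defined by a homotopy. -/
noncomputable def HolomorphicPath.double {n : SimplexCategory} (p : HolomorphicPath F X n.len) :
    C(stdSimplex ℝ (Fin (n.double.len + 1)), X) :=
  -- The fold is not monotone, so restriction along arbitrary maps of vertices is needed here.
  (p.comp (doubleFold n)).restrict (doubleSide n)

lemma HolomorphicPath.double_comp {n m : SimplexCategory} (p : HolomorphicPath F X m.len)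
    (θ : n ⟶ m) :
    (p.comp θ.toOrderHom).double (n := n) = p.double.comp
      ⟨stdSimplex.map (doubleMap θ).toOrderHom, stdSimplex.continuous_map _⟩ := by
  rw [double, double, ← comp_restrict, comp_comp, comp_comp, doubleFold_comp_map,
    doubleSide_comp_map]

lemma HolomorphicPath.restrict_zero {n : ℕ} (p : HolomorphicPath F X n)
    (x : stdSimplex ℝ (Fin (n + 1))) : p.restrict (fun _ => 0) x = p.path (x, 0) :=
  congrArg (fun u => p.path (x, u)) (stdSimplex.parameter_zero x)

lemma HolomorphicPath.restrict_one {n : ℕ} (p : HolomorphicPath F X n)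
    (x : stdSimplex ℝ (Fin (n + 1))) :
    p.restrict (fun _ => 1) x = p.final (AffineSimplex.ofStdSimplex n x) :=
  (congrArg (fun u => p.path (x, u)) (stdSimplex.parameter_one x)).trans (p.path_one x)

lemma HolomorphicPath.double_inl {n : SimplexCategory} (p : HolomorphicPath F X n.len)
    (x : stdSimplex ℝ (Fin (n.len + 1))) :
    p.double (stdSimplex.map (doubleInl n).toOrderHom x) = p.path (x, 0) := by
  have h := (p.comp (doubleFold n)).comp_restrict (doubleInl n).toOrderHom (doubleSide n)
  rw [comp_comp, doubleFold_comp_inl, doubleSide_comp_inl, comp_id] at h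
  exact (DFunLike.congr_fun h x).symm.trans (p.restrict_zero x)

lemma HolomorphicPath.double_inr {n : SimplexCategory} (p : HolomorphicPath F X n.len)
    (x : stdSimplex ℝ (Fin (n.len + 1))) :
    p.double (stdSimplex.map (doubleInr n).toOrderHom x) =
      p.final (AffineSimplex.ofStdSimplex n.len x) := by
  have h := (p.comp (doubleFold n)).comp_restrict (doubleInr n).toOrderHom (doubleSide n)
  rw [comp_comp, doubleFold_comp_inr, doubleSide_comp_inr, comp_id] at h
  exact (DFunLike.congr_fun h x).symm.trans (p.restrict_one x)

/-- The doubling of the singular set defined by a section of the simplicial set of homotopies. -/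
noncomputable def holomorphicPathSet.doubling
    (s : TopCat.toSSet.obj (TopCat.of X) ⟶ holomorphicPathSet F X) :
    SSet.Doubling (TopCat.toSSet.obj (TopCat.of X)) (TopCat.toSSet.obj (TopCat.of X)) where
  app n σ := ((TopCat.of X).toSSetObjEquiv (op n.double)).symm
    (show HolomorphicPath F X n.len from s.app (op n) σ).double
  naturality {n m} θ σ := by
    rw [NatTrans.naturality_apply]
    exact congrArg ((TopCat.of X).toSSetObjEquiv (op n.double)).symm
      (HolomorphicPath.double_comp (s.app (op m) σ) θ)

variable (F X) in
/-- The doubling of the affine singular set. -/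
noncomputable def affineSingularSet.doubling :
    SSet.Doubling (affineSingularSet F X) (affineSingularSet F X) where
  app n g := ⟨g.1 ∘ AffineSimplex.map (doubleFold n), g.2.comp (AffineSimplex.contMDiff_map _)⟩
  naturality {n m} θ g := by
    refine Subtype.ext (funext fun t => ?_)
    change g.1 (AffineSimplex.map θ.toOrderHom (AffineSimplex.map (doubleFold n) t)) =
      g.1 (AffineSimplex.map (doubleFold m) (AffineSimplex.map (doubleMap θ).toOrderHom t))
    rw [AffineSimplex.map_comp, AffineSimplex.map_comp, doubleFold_comp_map]

/-- On eX the section gives constant homotopies, and the double of a constant homotopy is g composed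
with the fold A_{2n+1} → A_n. This is again holomorphic, so the doubling of sX restricts to that of
eX. -/
lemma isWeakEquivalence_of_section
    (s : TopCat.toSSet.obj (TopCat.of X) ⟶ holomorphicPathSet F X)
    (hs : s ≫ holomorphicPathSet.source F X = 𝟙 _)
    (hi : affineSingularSetInclusion F X ≫ s = holomorphicPathSet.const F X) :
    SSet.IsWeakEquivalence (affineSingularSetInclusion F X) := by
  refine SSet.isWeakEquivalence_of_doubling _ (s ≫ holomorphicPathSet.target F X) ?_
    (holomorphicPathSet.doubling s) (affineSingularSet.doubling F X) (fun n σ => ?_)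
    (fun n σ => ?_) fun n g => ?_
  · rw [← Category.assoc, hi]
    rfl
  · have h1 : (s ≫ holomorphicPathSet.source F X).app (op n) σ = σ := by rw [hs]; rfl
    refine Eq.trans ?_ h1
    apply ((TopCat.of X).toSSetObjEquiv (op n)).injective
    ext x
    exact HolomorphicPath.double_inl (s.app (op n) σ) x
  · apply ((TopCat.of X).toSSetObjEquiv (op n)).injective
    ext x
    exact HolomorphicPath.double_inr (s.app (op n) σ) x
  · have h1 : s.app (op n) ((affineSingularSetInclusion F X).app (op n) g) =
        (holomorphicPathSet.const F X).app (op n) g := by rw [← hi]; rfl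
    refine congrArg ((TopCat.of X).toSSetObjEquiv (op n.double)).symm ?_
    rw [h1]
    refine (congrArg (fun p => HolomorphicPath.restrict p (doubleSide n))
      (HolomorphicPath.const_comp g.1 g.2 (doubleFold n))).trans ?_
    rfl

theorem mainTheorem1 (F : Type v) [NormedAddCommGroup F] [NormedSpace ℂ F] [FiniteDimensional ℂ F]
    (X : Type u) [TopologicalSpace X] [T2Space X] [ChartedSpace F X] [IsManifold 𝓘(ℂ, F) ω X]
    (hX : IsOka F X) : IsHomotopicallyElliptic F X := by
  obtain ⟨s, hs, hi⟩ := holomorphicPathSet.exists_section hX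
  have hr : affineSingularSetInclusion F X ≫ s ≫ holomorphicPathSet.target F X = 𝟙 _ := by
    rw [← Category.assoc, hi]
    rfl
  exact ⟨SSet.kanComplex_of_retract _ _ hr, mono_affineSingularSetInclusion F X,
    isWeakEquivalence_of_section s hs hi, isStrongDeformationRetract_of_section s hs hi⟩

end Conclusion
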